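/- Let $\Phi$ be a reduced irreducible (crystallographic) root system of rank $\geq 2$, let $G$ be the universal (simply connected) Chevalley–Demazure group scheme over $\mathbb{Z}$ of type $\Phi$, with its root subgroups $e_\alpha\colon \mathbb{G}_a \to G$ ($\alpha\in\Phi$), and let $R$ be a commutative ring such that $(\Phi,R)$ is a nice pair, i.e. $2\in R^\times$ if $\Phi$ contains a subsystem of type $B_2$, and $2,3\in R^\times$ if $\Phi$ is of type $G_2$. Let $G(R)^+\subset G(R)$ be the elementary subgroup, i.e. the subgroup generated by all $e_\alpha(t)$, $\alpha\in\Phi$, $t\in R$. Let $K$ be an algebraically closed field and let $\rho\colon G(R)^+\to GL_n(K)$ be a representation (a homomorphism of abstract groups). Set $H=\overline{\rho(G(R)^+)}$ (Zariski closure in $GL_n(K)$). Then there exist a commutative algebraic ring $A$ with identity over $K$ (an affine algebraic variety over $K$ with a structure of commutative ring with identity whose operations are regular maps) and a homomorphism of abstract rings $f\colon R\to A$ with Zariski-dense image such that for every root $\alpha\in\Phi$ there is an injective regular map $\psi_\alpha\colon A\to H$ satisfying $$\rho(e_\alpha(t))=\psi_\alpha(f(t))\qquad\text{for all } t\in R.$$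 -/

import Mathlib

open MvPolynomial LieAlgebra LieAlgebra.IsKilling

noncomputable section

/-! ### Coordinates on `GL_N` -/

/-- The coordinates used on `GL_N`: the entries of a matrix and the entries of its inverse. -/
abbrev GLCoord (N : ℕ) : Type := (Fin N × Fin N) ⊕ (Fin N × Fin N)

/-- The entries of `g` and of `g⁻¹`; this embeds `GL_N` as a closed subscheme of affine
`2N²`-space. -/
def glCoord {N : ℕ} {S : Type*} [CommRing S] (g : GL (Fin N) S) : GLCoord N → S :=
  Sum.elim (fun p => (g : Matrix (Fin N) (Fin N) S) p.1 p.2)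
    (fun p => ((g⁻¹ : GL (Fin N) S) : Matrix (Fin N) (Fin N) S) p.1 p.2)

/-- Evaluation of an integral polynomial at a point with coordinates in a commutative ring. -/
def intEval {σ S : Type*} [CommRing S] (x : σ → S) : MvPolynomial σ ℤ →+* S :=
  eval₂Hom (Int.castRingHom S) x

/-- The Zariski closure in `GL_n(K)` of a subset. -/
def glZariskiClosure {n : ℕ} {K : Type*} [Field K] (S : Set (GL (Fin n) K)) :
    Set (GL (Fin n) K) :=
  {g | ∀ p : MvPolynomial (GLCoord n) K,
    (∀ h ∈ S, aeval (glCoord h) p = 0) → aeval (glCoord g) p = 0}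

/-! ### Auxiliary facts on integral polynomial functions on `GL_N` -/

section

variable {N : ℕ} {S T : Type*} [CommRing S] [CommRing T]

lemma glCoord_map (f : S →+* T) (g : GL (Fin N) S) :
    glCoord (Matrix.GeneralLinearGroup.map f g) = fun c => f (glCoord g c) := by
  funext c
  rcases c with c | c
  · simp [glCoord]
  · simp only [glCoord, ← map_inv, Sum.elim_inr]
    exact Matrix.GeneralLinearGroup.map_apply f c.1 c.2 g⁻¹

lemma intEval_glCoord_map (f : S →+* T) (g : GL (Fin N) S) (p : MvPolynomial (GLCoord N) ℤ) :
    intEval (glCoord (Matrix.GeneralLinearGroup.map f g)) p = f (intEval (glCoord g) p) := by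
  rw [glCoord_map]
  simp only [intEval, coe_eval₂Hom]
  rw [eval₂_comp_left f]
  congr 1
  exact Subsingleton.elim _ _

/-- The polynomial `p(x y)` in `y`, with coefficients the polynomials in `x`. -/
def comulPoly (p : MvPolynomial (GLCoord N) ℤ) :
    MvPolynomial (GLCoord N) (MvPolynomial (GLCoord N) ℤ) :=
  intEval (Sum.elim
    (fun c => ∑ k, C (X (Sum.inl (c.1, k))) * X (Sum.inl (k, c.2)))
    (fun c => ∑ k, X (Sum.inr (c.1, k)) * C (X (Sum.inr (k, c.2))))) p

lemma eval_comulPoly (g h : GL (Fin N) S) (p : MvPolynomial (GLCoord N) ℤ) :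
    eval₂Hom (intEval (glCoord g)) (glCoord h) (comulPoly p) = intEval (glCoord (g * h)) p := by
  change eval₂Hom (intEval (glCoord g)) (glCoord h) (eval₂ (Int.castRingHom _) _ p) = _
  rw [eval₂_comp_left (eval₂Hom (intEval (glCoord g)) (glCoord h))]
  simp only [intEval, coe_eval₂Hom]
  congr 1
  · exact Subsingleton.elim _ _
  · funext c
    rcases c with c | c <;> simp [glCoord, Matrix.mul_apply, -Matrix.coe_units_inv]

lemma exists_sum_C_mul_map {σ O : Type*} [CommRing O] [Module.IsTorsionFree ℤ O]
    (q : MvPolynomial σ O) :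
    ∃ (k : ℕ) (c : Fin k → O) (_ : LinearIndependent ℤ c) (b : Fin k → MvPolynomial σ ℤ),
      q = ∑ j, C (c j) * MvPolynomial.map (Int.castRingHom O) (b j) := by
  classical
  let s : Set O := (fun m => coeff m q) '' (q.support : Set (σ →₀ ℕ))
  have hs : s.Finite := q.support.finite_toSet.image _
  let M := Submodule.span ℤ s
  have : Module.Finite ℤ M := Module.Finite.span_of_finite ℤ hs
  let B := Module.finBasis ℤ M
  have hmem : ∀ m, coeff m q ∈ M := by
    intro m
    by_cases hm : m ∈ q.support
    · exact Submodule.subset_span ⟨m, hm, rfl⟩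
    · rw [notMem_support_iff.1 hm]; exact zero_mem _
  refine ⟨_, fun j => (B j : O), ?_,
    fun j => ∑ m ∈ q.support, monomial m (B.repr ⟨coeff m q, hmem m⟩ j), ?_⟩
  · exact B.linearIndependent.map' M.subtype (Submodule.ker_subtype _)
  · conv_lhs => rw [q.as_sum]
    simp only [map_sum, Finset.mul_sum]
    rw [Finset.sum_comm]
    refine Finset.sum_congr rfl fun m _ => ?_
    simp only [map_monomial, C_mul_monomial]
    rw [← map_sum]
    congr 1
    have := congrArg (Subtype.val) (B.sum_repr ⟨coeff m q, hmem m⟩)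
    simp only [AddSubmonoidClass.coe_finsetSum] at this
    refine this.symm.trans ?_
    refine Finset.sum_congr rfl fun j _ => ?_
    simp [mul_comm]

end

/-! ### Chevalley bases and admissible lattices -/

section Chevalley

variable {ι V W : Type*} [Finite ι] [AddCommGroup V] [Module ℝ V] [AddCommGroup W] [Module ℝ W]
  (P : RootPairing ι ℝ V W) [P.IsCrystallographic]
  {L : Type*} [LieRing L] [LieAlgebra ℂ L] [FiniteDimensional ℂ L] [LieAlgebra.IsKilling ℂ L]
  (H : LieSubalgebra ℂ L) [H.IsCartanSubalgebra]

/-- A Chevalley basis of the semisimple complex Lie algebra `L` relative to the Cartan subalgebra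
`H`, together with an identification of the root system of `(L, H)` with `Φ = P`. -/
structure ChevalleyBasis where
  /-- the identification of `Φ` with the set of roots of `(L, H)` -/
  index : ι ≃ H.root
  pairing_index (i j : ι) :
    (rootSystem H).pairingIn ℤ (index i) (index j) = P.pairingIn ℤ i j
  /-- the root vectors -/
  vec : ι → L
  vec_mem (i : ι) : vec i ∈ rootSpace H (index i : LieModule.Weight ℂ H L)
  /-- `[x_α, x_{-α}]` is the coroot of `α` -/
  lie_vec_neg (i : ι) : ⁅vec i, vec (P.reflectionPerm i i)⁆ =
    ((coroot (index i : LieModule.Weight ℂ H L) : H) : L)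
  /-- `[x_α, x_β] = ±(p + 1) x_{α + β}`, where `β - p α, …, β, …` is the `α`-string through `β` -/
  lie_vec_add (i j k : ι) (h : P.root k = P.root i + P.root j) :
    ⁅vec i, vec j⁆ = (P.chainBotCoeff i j + 1) • vec k ∨
    ⁅vec i, vec j⁆ = -((P.chainBotCoeff i j + 1) • vec k)

variable {P H}

/-- A finite-dimensional representation of `L` with a chosen admissible lattice (and a basis of that
lattice, so that the representation is on `ℂ^N` and the lattice is `ℤ^N`) whose weights generate the
full weight lattice. The construction of the universal (simply connected) Chevalley–Demazure group
scheme starts from such a lattice. -/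
structure UniversalLattice (B : ChevalleyBasis P H) (N : ℕ) where
  /-- the representation -/
  rep : L →ₗ[ℂ] Matrix (Fin N) (Fin N) ℂ
  rep_lie (x y : L) : rep ⁅x, y⁆ = rep x * rep y - rep y * rep x
  /-- the matrix of the divided power `x_α ^ k / k!` on the lattice -/
  divPow : ι → ℕ → Matrix (Fin N) (Fin N) ℤ
  /-- the lattice is stable under all `x_α ^ k / k!` -/
  map_divPow (i : ι) (k : ℕ) :
    (divPow i k).map (Int.cast : ℤ → ℂ) = ((k.factorial : ℂ)⁻¹) • (rep (B.vec i)) ^ k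
  /-- every integral weight is an integral combination of weights of the representation -/
  weights_generate (w : Module.Dual ℂ H)
    (hw : ∀ i : ι, ∃ z : ℤ, w (coroot (B.index i : LieModule.Weight ℂ H L)) = z) :
    w ∈ AddSubgroup.closure {μ : Module.Dual ℂ H |
      ∃ v : Fin N → ℂ, v ≠ 0 ∧ ∀ h : H, (rep (h : L)).mulVec v = μ h • v}

namespace UniversalLattice

variable {B : ChevalleyBasis P H} {N : ℕ} (C : UniversalLattice B N)

/-! ### The root subgroups -/

lemma intCast_map_injective :
    Function.Injective (fun A : Matrix (Fin N) (Fin N) ℤ => A.map (Int.cast : ℤ → ℂ)) := by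
  intro A A' h
  ext i j
  have := congrFun (congrFun h i) j
  simpa using this

lemma rep_pow_eq_zero (i : ι) : (C.rep (B.vec i)) ^ N = 0 := by
  let _ : LieRingModule L (Fin N → ℂ) :=
    { bracket := fun x v => (C.rep x).mulVec v
      add_lie := fun x y v => by
        rw [map_add, Matrix.add_mulVec]
      lie_add := fun x v w => Matrix.mulVec_add _ _ _
      leibniz_lie := fun x y v => by
        change (C.rep x).mulVec ((C.rep y).mulVec v) =
          (C.rep ⁅x, y⁆).mulVec v + (C.rep y).mulVec ((C.rep x).mulVec v)
        rw [C.rep_lie, Matrix.sub_mulVec, Matrix.mulVec_mulVec, Matrix.mulVec_mulVec,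
          sub_add_cancel] }
  let _ : LieModule ℂ L (Fin N → ℂ) :=
    { smul_lie := fun t x v => by
        change (C.rep (t • x)).mulVec v = t • (C.rep x).mulVec v
        rw [map_smul, Matrix.smul_mulVec]
      lie_smul := fun t x v => Matrix.mulVec_smul _ _ _ }
  have hne : ((B.index i : LieModule.Weight ℂ H L) : H → ℂ) ≠ 0 := by
    have := (B.index i).2
    exact (LieSubalgebra.isNonZero_coe_root (B.index i))
  obtain ⟨k, hk⟩ := LieModule.isNilpotent_toEnd_of_mem_rootSpace (M := Fin N → ℂ) H hne
    (B.vec_mem i)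
  have he : LieModule.toEnd ℂ L (Fin N → ℂ) (B.vec i) = Matrix.toLin' (C.rep (B.vec i)) := by
    ext; rfl
  have hnil : IsNilpotent (C.rep (B.vec i)) := by
    refine ⟨k, ?_⟩
    apply Matrix.toLin'.injective
    rw [Matrix.toLin'_pow, ← he, hk, map_zero]
  have := (Matrix.isNilpotent_charpoly_sub_pow_of_isNilpotent hnil)
  have h2 := Matrix.aeval_self_charpoly (C.rep (B.vec i))
  rw [sub_eq_zero.1 this.eq_zero] at h2
  simpa using h2

lemma divPow_zero (i : ι) : C.divPow i 0 = 1 := by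
  apply intCast_map_injective
  simp [C.map_divPow]

lemma divPow_of_le (i : ι) {k : ℕ} (hk : N ≤ k) : C.divPow i k = 0 := by
  apply intCast_map_injective
  simp [C.map_divPow, pow_eq_zero_of_le hk (C.rep_pow_eq_zero i)]

lemma divPow_mul (i : ι) (k l : ℕ) :
    C.divPow i k * C.divPow i l = ((k + l).choose k) • C.divPow i (k + l) := by
  apply intCast_map_injective
  have h1 : (C.divPow i k * C.divPow i l).map (Int.cast : ℤ → ℂ) =
      (C.divPow i k).map (Int.cast : ℤ → ℂ) * (C.divPow i l).map (Int.cast : ℤ → ℂ) :=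
    Matrix.map_mul (f := Int.castRingHom ℂ)
  have h2 : ((((k + l).choose k) • C.divPow i (k + l))).map (Int.cast : ℤ → ℂ) =
      (((k + l).choose k : ℕ) : ℂ) • (C.divPow i (k + l)).map (Int.cast : ℤ → ℂ) := by
    ext a b
    rw [Matrix.map_apply, Matrix.smul_apply, Matrix.smul_apply, Matrix.map_apply, nsmul_eq_mul,
      smul_eq_mul]
    push_cast
    rfl
  show (C.divPow i k * C.divPow i l).map (Int.cast : ℤ → ℂ) =
    ((((k + l).choose k) • C.divPow i (k + l))).map (Int.cast : ℤ → ℂ)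
  rw [h1, h2, C.map_divPow, C.map_divPow, C.map_divPow, smul_mul_smul_comm, ← pow_add, smul_smul]
  congr 1
  rw [Nat.cast_add_choose]
  have a := Nat.cast_ne_zero (R := ℂ).2 (k + l).factorial_ne_zero
  field_simp

/-- The matrix `∑ t ^ k (x_α ^ k / k!)` of `exp (t x_α)` over a commutative ring `S` (the sum is
finite, since `x_α ^ N = 0`). -/
def rootMatrix {S : Type*} [CommRing S] (i : ι) (t : S) : Matrix (Fin N) (Fin N) S :=
  ∑ k ∈ Finset.range N, t ^ k • (C.divPow i k).map (Int.cast : ℤ → S)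

section

variable {S : Type*} [CommRing S]

lemma rootMatrix_eq (i : ι) (t : S) {M : ℕ} (hM : N ≤ M) :
    C.rootMatrix i t = ∑ k ∈ Finset.range M, t ^ k • (C.divPow i k).map (Int.cast : ℤ → S) := by
  unfold rootMatrix
  apply Finset.sum_subset (by simpa using hM)
  intro k _ hk
  rw [C.divPow_of_le i (by simpa using hk)]
  ext; simp

lemma rootMatrix_zero (i : ι) : C.rootMatrix i (0 : S) = 1 := by
  rw [C.rootMatrix_eq i 0 (Nat.le_succ N), Finset.sum_eq_single 0]
  · rw [C.divPow_zero]; ext a b; simp [Matrix.one_apply]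
  · intro k _ hk; simp [hk]
  · simp

lemma rootMatrix_add (i : ι) (s t : S) :
    C.rootMatrix i (s + t) = C.rootMatrix i s * C.rootMatrix i t := by
  have hc : ∀ k l : ℕ, (C.divPow i k).map (Int.cast : ℤ → S) * (C.divPow i l).map (Int.cast : ℤ → S)
      = (((k + l).choose k : ℕ) : S) • (C.divPow i (k + l)).map (Int.cast : ℤ → S) := by
    intro k l
    have h1 : (C.divPow i k * C.divPow i l).map (Int.cast : ℤ → S) =
        (C.divPow i k).map (Int.cast : ℤ → S) * (C.divPow i l).map (Int.cast : ℤ → S) :=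
      Matrix.map_mul (f := Int.castRingHom S)
    rw [← h1, C.divPow_mul]
    ext a b
    rw [Matrix.map_apply, Matrix.smul_apply, Matrix.smul_apply, Matrix.map_apply, nsmul_eq_mul,
      smul_eq_mul]
    push_cast
    rfl
  have hz : ∀ k, N ≤ k → (C.divPow i k).map (Int.cast : ℤ → S) = 0 := by
    intro k hk
    rw [C.divPow_of_le i hk]; ext; simp
  rw [C.rootMatrix_eq i (s + t) (show N ≤ 2 * N by omega), rootMatrix, rootMatrix,
    Finset.sum_mul_sum, ← Finset.sum_product']
  have hfib : ∀ k ∈ Finset.range (2 * N),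
      (s + t) ^ k • (C.divPow i k).map (Int.cast : ℤ → S) =
      ∑ p ∈ Finset.HasAntidiagonal.antidiagonal k, (s ^ p.1 • (C.divPow i p.1).map (Int.cast : ℤ → S)) *
        (t ^ p.2 • (C.divPow i p.2).map (Int.cast : ℤ → S)) := by
    intro k _
    rw [(Commute.all s t).add_pow', Finset.sum_smul]
    refine Finset.sum_congr rfl fun p hp => ?_
    rw [Finset.HasAntidiagonal.mem_antidiagonal] at hp
    rw [smul_mul_smul_comm, hc, hp, smul_smul, nsmul_eq_mul, mul_comm]
  rw [Finset.sum_congr rfl hfib, Finset.sum_sigma']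
  symm
  refine Finset.sum_bij_ne_zero (fun p _ _ => ⟨p.1 + p.2, p⟩) ?_ ?_ ?_ ?_
  · intro p hp _
    simp only [Finset.mem_product, Finset.mem_range] at hp
    simp only [Finset.mem_sigma, Finset.mem_range, Finset.HasAntidiagonal.mem_antidiagonal, and_true]
    omega
  · intro p _ _ q _ _ h
    simp only [Sigma.mk.injEq] at h
    exact eq_of_heq h.2
  · rintro ⟨k, p⟩ hp hne
    simp only [Finset.mem_sigma, Finset.mem_range, Finset.HasAntidiagonal.mem_antidiagonal] at hp
    obtain ⟨_, rfl⟩ := hp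
    refine ⟨p, ?_, hne, rfl⟩
    simp only [Finset.mem_product, Finset.mem_range]
    constructor <;>
    · by_contra! h
      exact hne (by simp [hz _ h])
  · intros; rfl

/-- The root element `e_α(t)` as an element of `GL_N(S)`. -/
def rootGL (i : ι) (t : S) : GL (Fin N) S where
  val := C.rootMatrix i t
  inv := C.rootMatrix i (-t)
  val_inv := by rw [← C.rootMatrix_add, add_neg_cancel, C.rootMatrix_zero]
  inv_val := by rw [← C.rootMatrix_add, neg_add_cancel, C.rootMatrix_zero]

lemma rootGL_inv (i : ι) (t : S) : (C.rootGL i t)⁻¹ = C.rootGL i (-t) := by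
  ext a b; rfl

end

/-! ### The universal Chevalley–Demazure group scheme -/

/-- The subgroup of `GL_N(S)` generated by the root elements `e_α(t)`, `t ∈ S`. For `S = ℂ` this is
the universal (simply connected) complex Chevalley group, in Steinberg's construction. -/
def elemGL (S : Type*) [CommRing S] : Subgroup (GL (Fin N) S) :=
  Subgroup.closure {g | ∃ (i : ι) (t : S), g = C.rootGL i t}

/-- The ideal of `ℤ[GL_N]` (polynomials in the entries of a matrix and of its inverse) of the
functions with integral coefficients that vanish on the complex Chevalley group. -/
def ideal : Ideal (MvPolynomial (GLCoord N) ℤ) :=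
  ⨅ g : C.elemGL ℂ, RingHom.ker (intEval (glCoord (g : GL (Fin N) ℂ)))

/-- The coordinate ring `ℤ[G]`: `G` is the closed subscheme of `GL_N` over `ℤ` that is the Zariski
closure of the complex Chevalley group. Since the weights of the lattice generate the weight
lattice, this is the split simply connected group scheme of type `Φ`, for every choice of lattice. -/
abbrev CoordinateRing : Type := MvPolynomial (GLCoord N) ℤ ⧸ C.ideal

/-! #### `G` is a group scheme containing the root subgroups -/

section

variable {S T : Type*} [CommRing S] [CommRing T]

lemma rootGL_map (f : S →+* T) (i : ι) (t : S) :
    Matrix.GeneralLinearGroup.map f (C.rootGL i t) = C.rootGL i (f t) := by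
  ext a b
  simp [rootGL, rootMatrix, Matrix.sum_apply]

lemma map_mem_elemGL (f : S →+* T) {g : GL (Fin N) S} (hg : g ∈ C.elemGL S) :
    Matrix.GeneralLinearGroup.map f g ∈ C.elemGL T := by
  induction hg using Subgroup.closure_induction with
  | mem x hx =>
    obtain ⟨i, t, rfl⟩ := hx
    exact Subgroup.subset_closure ⟨i, f t, C.rootGL_map f i t⟩
  | one => rw [map_one]; exact one_mem _
  | mul x y _ _ hx hy => rw [map_mul]; exact mul_mem hx hy
  | inv x _ hx => rw [map_inv]; exact inv_mem hx

lemma exists_generic {g : GL (Fin N) S} (hg : g ∈ C.elemGL S) :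
    ∃ w ∈ C.elemGL (MvPolynomial S ℤ),
      Matrix.GeneralLinearGroup.map (intEval (id : S → S)) w = g := by
  induction hg using Subgroup.closure_induction with
  | mem x hx =>
    obtain ⟨i, t, rfl⟩ := hx
    refine ⟨C.rootGL i (X t), Subgroup.subset_closure ⟨i, X t, rfl⟩, ?_⟩
    rw [C.rootGL_map]; simp [intEval]
  | one => exact ⟨1, one_mem _, map_one _⟩
  | mul x y _ _ hx hy =>
    obtain ⟨u, hu, rfl⟩ := hx
    obtain ⟨v, hv, rfl⟩ := hy
    exact ⟨u * v, mul_mem hu hv, map_mul _ _ _⟩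
  | inv x _ hx =>
    obtain ⟨u, hu, rfl⟩ := hx
    exact ⟨u⁻¹, inv_mem hu, map_inv _ _⟩

/-- An integral polynomial that vanishes on the elementary group over an infinite domain of
characteristic zero vanishes on it over every commutative ring. -/
lemma intEval_eq_zero_of_forall [IsDomain T] [CharZero T] (p : MvPolynomial (GLCoord N) ℤ)
    (h : ∀ g ∈ C.elemGL T, intEval (glCoord g) p = 0) {g : GL (Fin N) S} (hg : g ∈ C.elemGL S) :
    intEval (glCoord g) p = 0 := by
  obtain ⟨w, hw, rfl⟩ := C.exists_generic hg
  rw [intEval_glCoord_map]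
  suffices hz : intEval (glCoord w) p = 0 by rw [hz, map_zero]
  apply MvPolynomial.map_injective (Int.castRingHom T) (RingHom.injective_int _)
  have : Infinite T := Infinite.of_injective _ (Nat.cast_injective (R := T))
  apply MvPolynomial.funext
  intro x
  have := h _ (C.map_mem_elemGL (intEval x) hw)
  rw [intEval_glCoord_map] at this
  rw [map_zero, map_zero, MvPolynomial.eval_map]
  exact this

lemma mem_ideal_iff (p : MvPolynomial (GLCoord N) ℤ) :
    p ∈ C.ideal ↔ ∀ g ∈ C.elemGL ℂ, intEval (glCoord g) p = 0 := by
  simp [ideal, RingHom.mem_ker]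

lemma mem_ideal_of_int (p : MvPolynomial (GLCoord N) ℤ)
    (h : ∀ g ∈ C.elemGL ℤ, intEval (glCoord g) p = 0) : p ∈ C.ideal :=
  (C.mem_ideal_iff p).2 fun _ hg => C.intEval_eq_zero_of_forall p h hg

lemma torsionFree_coordinateRing : Module.IsTorsionFree ℤ C.CoordinateRing := by
  refine .of_smul_eq_zero fun n x hx => ?_
  rw [or_iff_not_imp_left]
  intro hn
  obtain ⟨p, rfl⟩ := Ideal.Quotient.mk_surjective x
  rw [zsmul_eq_mul, ← map_intCast (Ideal.Quotient.mk C.ideal), ← map_mul,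
    Ideal.Quotient.eq_zero_iff_mem, C.mem_ideal_iff] at hx
  rw [Ideal.Quotient.eq_zero_iff_mem, C.mem_ideal_iff]
  intro g hg
  have := hx g hg
  rw [map_mul, map_intCast] at this
  exact (mul_eq_zero.1 this).resolve_left (by exact_mod_cast hn)

lemma intEval_mul_eq_zero {p : MvPolynomial (GLCoord N) ℤ} (hp : p ∈ C.ideal)
    {g h : GL (Fin N) S} (hg : ∀ q ∈ C.ideal, intEval (glCoord g) q = 0)
    (hh : ∀ q ∈ C.ideal, intEval (glCoord h) q = 0) : intEval (glCoord (g * h)) p = 0 := by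
  have := C.torsionFree_coordinateRing
  obtain ⟨k, c, hc, b, hb⟩ := exists_sum_C_mul_map
    (MvPolynomial.map (Ideal.Quotient.mk C.ideal) (comulPoly p))
  have key : ∀ j, b j ∈ C.ideal := by
    intro j
    refine C.mem_ideal_of_int _ fun x hx => ?_
    have h0 : eval₂Hom (RingHom.id C.CoordinateRing) (fun i => ((glCoord x i : ℤ) : C.CoordinateRing))
        (MvPolynomial.map (Ideal.Quotient.mk C.ideal) (comulPoly p)) = 0 := by
      have h1 : eval₂Hom (RingHom.id _) (fun i => ((glCoord x i : ℤ) : MvPolynomial (GLCoord N) ℤ))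
          (comulPoly p) ∈ C.ideal := by
        rw [C.mem_ideal_iff]
        intro y hy
        have h2 := (C.mem_ideal_iff p).1 hp _
          (mul_mem hy (C.map_mem_elemGL (Int.castRingHom ℂ) hx))
        rw [← eval_comulPoly, glCoord_map] at h2
        rw [← h2]
        simp only [coe_eval₂Hom]
        rw [eval₂_comp_left (intEval (glCoord y))]
        congr 1
        funext i
        simp
      rw [← Ideal.Quotient.eq_zero_iff_mem] at h1
      rw [← h1]
      simp only [coe_eval₂Hom]
      rw [eval₂_map, eval₂_comp_left (Ideal.Quotient.mk C.ideal)]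
      congr 1
    rw [hb] at h0
    have h3 : ∑ j, (intEval (glCoord x) (b j)) • c j = 0 := by
      rw [← h0, map_sum]
      refine Finset.sum_congr rfl fun j _ => ?_
      rw [map_mul, zsmul_eq_mul, mul_comm]
      congr 1
      · simp
      · simp only [coe_eval₂Hom, eval₂_map, intEval]
        rw [← eq_intCast (Int.castRingHom C.CoordinateRing), eval₂_comp_left]
        congr 1
    exact Fintype.linearIndependent_iff.1 hc _ h3 j
  let φ : C.CoordinateRing →+* S := Ideal.Quotient.lift C.ideal (intEval (glCoord g)) hg
  have h4 : eval₂Hom φ (glCoord h) (MvPolynomial.map (Ideal.Quotient.mk C.ideal) (comulPoly p)) =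
      intEval (glCoord (g * h)) p := by
    rw [← eval_comulPoly]
    simp only [coe_eval₂Hom, eval₂_map]
    congr 1
  rw [← h4, hb, map_sum]
  refine Finset.sum_eq_zero fun j _ => ?_
  rw [map_mul]
  have h5 : eval₂Hom φ (glCoord h) (MvPolynomial.map (Int.castRingHom _) (b j)) = 0 := by
    rw [← hh _ (key j)]
    simp only [coe_eval₂Hom, eval₂_map, intEval]
    congr 1
    exact Subsingleton.elim _ _
  rw [h5, mul_zero]

lemma intEval_inv_eq_zero {p : MvPolynomial (GLCoord N) ℤ} (hp : p ∈ C.ideal)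
    {g : GL (Fin N) S} (hg : ∀ q ∈ C.ideal, intEval (glCoord g) q = 0) :
    intEval (glCoord g⁻¹) p = 0 := by
  have hsw : ∀ {S : Type _} [CommRing S] (y : GL (Fin N) S),
      intEval (glCoord y) (rename Sum.swap p) = intEval (glCoord y⁻¹) p := by
    intro S _ y
    simp only [intEval, coe_eval₂Hom, eval₂_rename]
    congr 1
    funext c
    rcases c with c | c <;> simp [glCoord]
  have hsw' : rename Sum.swap p ∈ C.ideal := by
    rw [C.mem_ideal_iff] at hp ⊢
    intro y hy
    have : intEval (glCoord y) (rename Sum.swap p) = intEval (glCoord y⁻¹) p := by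
      simp only [intEval, coe_eval₂Hom, eval₂_rename]
      congr 1
      funext c
      rcases c with c | c <;> simp [glCoord]
    rw [this]
    exact hp _ (inv_mem hy)
  rw [← hsw]
  exact hg _ hsw'

lemma intEval_one_eq_zero {p : MvPolynomial (GLCoord N) ℤ} (hp : p ∈ C.ideal) :
    intEval (glCoord (1 : GL (Fin N) S)) p = 0 :=
  C.intEval_eq_zero_of_forall p ((C.mem_ideal_iff p).1 hp) (one_mem _)

end

/-- The group `G(S)` of points of the universal Chevalley–Demazure group scheme in a commutative
ring `S`, as a subgroup of `GL_N(S)`: the matrices that satisfy all equations of `G`. -/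
def points (S : Type*) [CommRing S] : Subgroup (GL (Fin N) S) where
  carrier := {g | ∀ p ∈ C.ideal, intEval (glCoord g) p = 0}
  mul_mem' hg hh _ hp := C.intEval_mul_eq_zero hp hg hh
  one_mem' _ hp := C.intEval_one_eq_zero hp
  inv_mem' hg _ hp := C.intEval_inv_eq_zero hp hg

/-- The root element `e_α(t) ∈ G(S)`. -/
def root {S : Type*} [CommRing S] (i : ι) (t : S) : C.points S :=
  ⟨C.rootGL i t, fun p hp => C.intEval_eq_zero_of_forall p ((C.mem_ideal_iff p).1 hp)
    (Subgroup.subset_closure ⟨i, t, rfl⟩)⟩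

/-- The elementary subgroup `G(S)⁺ ⊆ G(S)`, generated by the root subgroups. -/
def elementary (S : Type*) [CommRing S] : Subgroup (C.points S) :=
  Subgroup.closure {g | ∃ (i : ι) (t : S), g = C.root i t}

/-- The root element `e_α(t)` as an element of `G(S)⁺`. -/
def elem {S : Type*} [CommRing S] (i : ι) (t : S) : C.elementary S :=
  ⟨C.root i t, Subgroup.subset_closure ⟨i, t, rfl⟩⟩

end UniversalLattice
end Chevalley

/-! ### Nice pairs -/

section NicePair

variable {ι V W : Type*} [AddCommGroup V] [Module ℝ V] [AddCommGroup W] [Module ℝ W]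
  (P : RootPairing ι ℝ V W) [P.IsCrystallographic]

/-- `Φ` contains a subsystem of type `B₂`: there are two roots that form a base of a root system of
type `B₂`. -/
def ContainsB2 : Prop :=
  ∃ i j : ι, P.pairingIn ℤ i j = -2 ∧ P.pairingIn ℤ j i = -1

/-- `(Φ, R)` is a nice pair: `2 ∈ Rˣ` if `Φ` contains a subsystem of type `B₂`, and `2, 3 ∈ Rˣ` if
`Φ` is of type `G₂`. -/
def IsNicePair (R : Type*) [CommRing R] : Prop :=
  (ContainsB2 P → IsUnit (2 : R)) ∧ (P.IsG2 → IsUnit (2 : R) ∧ IsUnit (3 : R))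

end NicePair

/-! ### Algebraic rings -/

section AlgebraicRing

variable {K : Type*} [Field K]

/-- Let `u : X → K^σ` and `v : X → K^τ` be the inclusions (or coordinates) of a closed subset and
the coordinates of a map on it. The map is regular if it is given by polynomials. -/
def IsRegularMap {X σ τ : Type*} (u : X → σ → K) (v : X → τ → K) : Prop :=
  ∃ F : τ → MvPolynomial σ K, ∀ (x : X) (j : τ), v x j = eval (u x) (F j)

variable (K) in
/-- A commutative algebraic ring with identity over `K` (to be used for `K` algebraically closed):
an affine algebraic variety, given as a Zariski closed subset of some affine space, with the
structure of a commutative ring with identity whose operations are regular maps. -/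
structure CommAlgebraicRing where
  /-- the dimension of the ambient affine space -/
  ambientDim : ℕ
  /-- the underlying variety -/
  carrier : Set (Fin ambientDim → K)
  isClosed : ∃ I : Ideal (MvPolynomial (Fin ambientDim) K), carrier = zeroLocus K I
  /-- the ring structure -/
  commRing : CommRing carrier
  regular_add : IsRegularMap
    (fun x : carrier × carrier => Sum.elim (x.1 : Fin ambientDim → K) (x.2 : Fin ambientDim → K))
    (fun x => ((x.1 + x.2 : carrier) : Fin ambientDim → K))
  regular_mul : IsRegularMap
    (fun x : carrier × carrier => Sum.elim (x.1 : Fin ambientDim → K) (x.2 : Fin ambientDim → K))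
    (fun x => ((x.1 * x.2 : carrier) : Fin ambientDim → K))
  regular_neg : IsRegularMap
    (fun x : carrier => (x : Fin ambientDim → K))
    (fun x => ((-x : carrier) : Fin ambientDim → K))

namespace CommAlgebraicRing

instance (A : CommAlgebraicRing K) : CommRing A.carrier := A.commRing

/-- A subset of `A` is Zariski dense if every polynomial function that vanishes on it vanishes
on `A`. -/
def IsZariskiDense (A : CommAlgebraicRing K) (S : Set A.carrier) : Prop :=
  ∀ p : MvPolynomial (Fin A.ambientDim) K,
    (∀ x ∈ S, eval (x : Fin A.ambientDim → K) p = 0) →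
      ∀ x : A.carrier, eval (x : Fin A.ambientDim → K) p = 0

end CommAlgebraicRing

end AlgebraicRing

end

/-! Write `x α t` for `ρ (e_α(t))`. The invariant of each root is an algebra of functions on `R`:
the subalgebra `coordAlg (x α)` of all maps `R → K` generated by the matrix entries of `x α t` and
of its inverse. A regular map between the closures of two images of `R` that is compatible with the
parametrizations amounts to an inclusion of such algebras, so the varieties appear only at the end.

If `α + β` is a root and no other positive combination of `α` and `β` is, the commutator of `x α s`
and `x β t` is `x (α + β) (m s t)` with `m` an integer that is a unit in `R`. Hence the entries of
`x (α + β) (m s t)` are polynomials in those of `x α s` and `x β t` (`HasMul`). Fixing one variable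
shows that the algebra of `α + β` lies in those of `α` and `β`. Applied also to `α = (α + β) +
(-β)`, this gives equality. If `2α + β` is a root as well, its factor in the conjugation relation is
even in `s` and disappears on dividing the relation at `s` by the one at `-s`. Irreducibility and
rank at least two connect any two roots by such steps (`eq_of_forall_root_add`), so all the algebras
coincide. In type `G₂` the long roots form a system of type `A₂`, treated by simple commutators, and
the short roots are compared with them in `coordAlg_eq_of_isG2`.

Once the algebras agree, the multiplication linking three roots becomes a polynomial formula for the
coordinates of `x k (s t)` in those of `x k s` and `x k t`. Addition and negation come from the
group law. The Zariski closure of the image of `R` under these coordinates is the ring `A`: the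
operations extend by the same polynomials, and the ring axioms extend from the dense image of `R`.
Every `x α` is polynomial in the coordinates of `x k` and conversely, which gives `ψ α` and its
injectivity (`exists_regularMap`).

The commutator relations are proved over `ℂ` by exponentials and transported to all commutative
rings through `ℤ[s, t]`. -/

noncomputable section

/-! ### Algebras of functions -/

section FunctionAlgebra

variable {K X Y Z : Type*} [Field K]

/-- Composition with `φ : Y → X`, as a homomorphism of algebras of functions. -/
def pullback (K : Type*) [Field K] (φ : Y → X) : (X → K) →ₐ[K] (Y → K) :=
  AlgHom.pi fun y => Pi.evalAlgHom K _ (φ y)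

/-- The algebra of functions on `X × Y` generated by the functions in `S` of the first variable and
the functions in `T` of the second variable. -/
def prodAlg (S : Subalgebra K (X → K)) (T : Subalgebra K (Y → K)) : Subalgebra K (X × Y → K) :=
  S.map (pullback K Prod.fst) ⊔ T.map (pullback K Prod.snd)

lemma comp_fst_mem_prodAlg {S : Subalgebra K (X → K)} (T : Subalgebra K (Y → K)) {g : X → K}
    (hg : g ∈ S) : (fun p : X × Y => g p.1) ∈ prodAlg S T :=
  (le_sup_left : S.map (pullback K Prod.fst) ≤ prodAlg S T) ⟨g, hg, rfl⟩

lemma comp_snd_mem_prodAlg (S : Subalgebra K (X → K)) {T : Subalgebra K (Y → K)} {g : Y → K}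
    (hg : g ∈ T) : (fun p : X × Y => g p.2) ∈ prodAlg S T :=
  (le_sup_right : T.map (pullback K Prod.snd) ≤ prodAlg S T) ⟨g, hg, rfl⟩

/-- Substitution is an algebra homomorphism, so only the two kinds of generators need checking.
Fixing a variable, rescaling it and restricting to the diagonal are all instances. -/
lemma comp_mem_of_mem_prodAlg {S : Subalgebra K (X → K)} {T : Subalgebra K (Y → K)}
    {U : Subalgebra K (Z → K)} {φ : Z → X} {χ : Z → Y} (hφ : ∀ g ∈ S, (fun z => g (φ z)) ∈ U)
    (hχ : ∀ g ∈ T, (fun z => g (χ z)) ∈ U) {g : X × Y → K} (hg : g ∈ prodAlg S T) :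
    (fun z => g (φ z, χ z)) ∈ U := by
  have : prodAlg S T ≤ U.comap (pullback K fun z => (φ z, χ z)) := by
    refine sup_le ?_ ?_
    · rintro _ ⟨f, hf, rfl⟩
      exact hφ f hf
    · rintro _ ⟨f, hf, rfl⟩
      exact hχ f hf
  exact this hg

lemma const_mem (U : Subalgebra K (X → K)) (a : K) : (fun _ : X => a) ∈ U :=
  U.algebraMap_mem a

lemma slice_left_mem {S : Subalgebra K (X → K)} {T : Subalgebra K (Y → K)} {g : X × Y → K}
    (hg : g ∈ prodAlg S T) (x : X) : (fun y => g (x, y)) ∈ T :=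
  comp_mem_of_mem_prodAlg (fun f _ => const_mem T (f x)) (fun _ h => h) hg

lemma slice_right_mem {S : Subalgebra K (X → K)} {T : Subalgebra K (Y → K)} {g : X × Y → K}
    (hg : g ∈ prodAlg S T) (y : Y) : (fun x => g (x, y)) ∈ S :=
  comp_mem_of_mem_prodAlg (fun _ h => h) (fun f _ => const_mem S (f y)) hg

/-- A map `f : Z → X` is dense for the algebra of functions `S` on `X` if a function in `S` that
vanishes on the range of `f` is zero. -/
def IsDenseFor (S : Subalgebra K (X → K)) (f : Z → X) : Prop :=
  ∀ g ∈ S, (∀ z, g (f z) = 0) → g = 0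

/-- Density is used one variable at a time, because each slice of a function in the product algebra
lies in the algebra of the remaining factor. -/
lemma IsDenseFor.prod {W : Type*} {S : Subalgebra K (X → K)} {T : Subalgebra K (Y → K)} {f : Z → X}
    {h : W → Y} (hf : IsDenseFor S f) (hh : IsDenseFor T h) :
    IsDenseFor (prodAlg S T) (Prod.map f h) := by
  intro g hg h0
  funext ⟨x, y⟩
  have h1 : ∀ z, (fun y => g (f z, y)) = 0 := fun z =>
    hh _ (slice_left_mem hg _) fun w => h0 (z, w)
  exact congrFun (hf _ (slice_right_mem hg y) fun z => congrFun (h1 z) y) x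

lemma IsDenseFor.eq {S : Subalgebra K (X → K)} {f : Z → X} (hf : IsDenseFor S f) {g h : X → K}
    (hg : g ∈ S) (hh : h ∈ S) (heq : ∀ z, g (f z) = h (f z)) : g = h :=
  sub_eq_zero.1 (hf _ (sub_mem hg hh) fun z => sub_eq_zero.2 (heq z))

lemma eval_mem_subalgebra {σ : Type*} (U : Subalgebra K (X → K)) {u : X → σ → K}
    (hu : ∀ j, (fun x => u x j) ∈ U) (p : MvPolynomial σ K) : (fun x => eval (u x) p) ∈ U := by
  induction p using MvPolynomial.induction_on with
  | C a => simpa using const_mem U a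
  | add p q hp hq =>
    simp only [map_add]
    exact add_mem hp hq
  | mul_X p j hp =>
    simp only [map_mul, eval_X]
    exact mul_mem hp (hu j)

/-- The algebra of the functions on `X` that are polynomials in the coordinates `u`. -/
def coordinateAlg {σ : Type*} (u : X → σ → K) : Subalgebra K (X → K) :=
  Algebra.adjoin K (Set.range fun j x => u x j)

lemma coordinate_mem {σ : Type*} (u : X → σ → K) (j : σ) : (fun x => u x j) ∈ coordinateAlg u :=
  Algebra.subset_adjoin ⟨j, rfl⟩

lemma coordinateAlg_le {σ : Type*} {u : X → σ → K} {U : Subalgebra K (X → K)}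
    (h : ∀ j, (fun x => u x j) ∈ U) : coordinateAlg u ≤ U :=
  Algebra.adjoin_le (by rintro _ ⟨j, rfl⟩; exact h j)

lemma exists_eval_of_mem_coordinateAlg {σ : Type*} {u : X → σ → K} {g : X → K}
    (hg : g ∈ coordinateAlg u) : ∃ p : MvPolynomial σ K, ∀ x, g x = eval (u x) p := by
  induction hg using Algebra.adjoin_induction with
  | mem x hx =>
    obtain ⟨j, rfl⟩ := hx
    exact ⟨MvPolynomial.X j, fun x => by simp⟩
  | algebraMap r => exact ⟨C r, fun x => by simp⟩
  | add f g _ _ hf hg =>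
    obtain ⟨p, hp⟩ := hf
    obtain ⟨q, hq⟩ := hg
    exact ⟨p + q, fun x => by simp [hp, hq]⟩
  | mul f g _ _ hf hg =>
    obtain ⟨p, hp⟩ := hf
    obtain ⟨q, hq⟩ := hg
    exact ⟨p * q, fun x => by simp [hp, hq]⟩

lemma prodAlg_coordinateAlg_le {σ τ : Type*} (u : X → σ → K) (v : Y → τ → K) :
    prodAlg (coordinateAlg u) (coordinateAlg v) ≤
      coordinateAlg fun p : X × Y => Sum.elim (u p.1) (v p.2) := by
  intro g hg
  refine comp_mem_of_mem_prodAlg (φ := Prod.fst) (χ := Prod.snd) (fun f hf => ?_)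
    (fun f hf => ?_) hg
  · obtain ⟨p, hp⟩ := exists_eval_of_mem_coordinateAlg hf
    simp only [hp]
    exact eval_mem_subalgebra _ (u := fun z : X × Y => u z.1)
      (fun j => coordinate_mem (fun p : X × Y => Sum.elim (u p.1) (v p.2)) (Sum.inl j)) p
  · obtain ⟨p, hp⟩ := exists_eval_of_mem_coordinateAlg hf
    simp only [hp]
    exact eval_mem_subalgebra _ (u := fun z : X × Y => v z.2)
      (fun j => coordinate_mem (fun p : X × Y => Sum.elim (u p.1) (v p.2)) (Sum.inr j)) p

end FunctionAlgebra

/-! ### Algebraic rings from dense parametrizations -/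

/-- A map from a ring `R` to affine space, such that the coordinates of a sum, a product and a
negative are polynomials in the coordinates of the operands. -/
structure RegularParametrization (R K : Type*) [CommRing R] [Field K] (d : ℕ) where
  /-- the map -/
  toFun : R → Fin d → K
  /-- the polynomials that give the sum -/
  addPoly : Fin d → MvPolynomial (Fin d ⊕ Fin d) K
  /-- the polynomials that give the product -/
  mulPoly : Fin d → MvPolynomial (Fin d ⊕ Fin d) K
  /-- the polynomials that give the negative -/
  negPoly : Fin d → MvPolynomial (Fin d) K
  map_add (s t : R) (j : Fin d) :
    toFun (s + t) j = eval (Sum.elim (toFun s) (toFun t)) (addPoly j)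
  map_mul (s t : R) (j : Fin d) :
    toFun (s * t) j = eval (Sum.elim (toFun s) (toFun t)) (mulPoly j)
  map_neg (t : R) (j : Fin d) : toFun (-t) j = eval (toFun t) (negPoly j)

namespace RegularParametrization

variable {R K : Type*} [CommRing R] [Field K] {d : ℕ} (y : RegularParametrization R K d)

/-- The Zariski closure of the image. -/
def closure : Set (Fin d → K) :=
  {x | ∀ p : MvPolynomial (Fin d) K, (∀ t, eval (y.toFun t) p = 0) → eval x p = 0}

/-- The parametrization as a map to the Zariski closure of its image. -/
def incl (t : R) : y.closure := ⟨y.toFun t, fun _ hp => hp t⟩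

/-- The regular functions on the closure. -/
def regular : Subalgebra K (y.closure → K) := coordinateAlg fun x : y.closure => (x : Fin d → K)

lemma isDenseFor_incl : IsDenseFor y.regular y.incl := by
  intro g hg h0
  obtain ⟨p, hp⟩ := exists_eval_of_mem_coordinateAlg hg
  funext x
  rw [hp]
  exact x.2 p fun t => (hp (y.incl t)).symm.trans (h0 t)

/-- A map to the closure whose coordinates belong to an algebra of functions. -/
def IsRegularTo {X : Type*} (U : Subalgebra K (X → K)) (u : X → y.closure) : Prop :=
  ∀ j, (fun x => (u x : Fin d → K) j) ∈ U

variable {y}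

/-- This is the principle of extension of identities: two regular maps that agree on a dense set
agree everywhere. -/
lemma ext_of_isDenseFor {X Z : Type*} {U : Subalgebra K (X → K)} {f : Z → X} (hf : IsDenseFor U f)
    {u v : X → y.closure} (hu : y.IsRegularTo U u) (hv : y.IsRegularTo U v)
    (h : ∀ z, u (f z) = v (f z)) (x : X) : u x = v x :=
  Subtype.ext <| funext fun j => congrFun (hf.eq (hu j) (hv j) fun z => by rw [h]) x

lemma isRegularTo_id : y.IsRegularTo y.regular id := fun j => coordinate_mem _ j

lemma IsRegularTo.fst {X Y : Type*} {U : Subalgebra K (X → K)} {u : X → y.closure}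
    (hu : y.IsRegularTo U u) (U' : Subalgebra K (Y → K)) :
    y.IsRegularTo (prodAlg U U') fun p => u p.1 :=
  fun j => comp_fst_mem_prodAlg U' (hu j)

lemma IsRegularTo.snd {X Y : Type*} {U : Subalgebra K (X → K)} {u : X → y.closure}
    (hu : y.IsRegularTo U u) (U' : Subalgebra K (Y → K)) :
    y.IsRegularTo (prodAlg U' U) fun p => u p.2 :=
  fun j => comp_snd_mem_prodAlg U' (hu j)

lemma isRegularTo_const {X : Type*} (U : Subalgebra K (X → K)) (a : y.closure) :
    y.IsRegularTo U fun _ => a :=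
  fun j => const_mem U ((a : Fin d → K) j)

/-- If `p` vanishes on the image of `R`, then `p` composed with the polynomials `F` vanishes on the
dense image of `R × R`, hence on all pairs of points of the closure. -/
lemma eval_elim_mem_closure {F : Fin d → MvPolynomial (Fin d ⊕ Fin d) K}
    {op : R → R → R} (hF : ∀ s t j, y.toFun (op s t) j =
      eval (Sum.elim (y.toFun s) (y.toFun t)) (F j)) (a b : y.closure) :
    (fun j => eval (Sum.elim (a : Fin d → K) (b : Fin d → K)) (F j)) ∈ y.closure := by
  intro p hp
  have hmem : (fun x : y.closure × y.closure =>
      eval (fun j => eval (Sum.elim (x.1 : Fin d → K) (x.2 : Fin d → K)) (F j)) p) ∈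
      prodAlg y.regular y.regular := by
    refine eval_mem_subalgebra _ (fun j => eval_mem_subalgebra _ (fun c => ?_) _) _
    rcases c with c | c
    · exact isRegularTo_id.fst _ c
    · exact isRegularTo_id.snd _ c
  refine congrFun (y.isDenseFor_incl.prod y.isDenseFor_incl _ hmem ?_) (a, b)
  rintro ⟨s, t⟩
  rw [← hp (op s t)]
  congr 2
  funext j
  exact (hF s t j).symm

lemma eval_mem_closure (a : y.closure) :
    (fun j => eval (a : Fin d → K) (y.negPoly j)) ∈ y.closure := by
  intro p hp
  have hmem : (fun x : y.closure => eval (fun j => eval (x : Fin d → K) (y.negPoly j)) p) ∈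
      y.regular :=
    eval_mem_subalgebra _ (fun j => eval_mem_subalgebra _ isRegularTo_id _) _
  refine congrFun (y.isDenseFor_incl _ hmem fun t => ?_) a
  rw [← hp (-t)]
  congr 2
  funext j
  exact (y.map_neg t j).symm

/-! ### The ring structure on the closure -/

instance : Add y.closure := ⟨fun a b => ⟨_, eval_elim_mem_closure y.map_add a b⟩⟩
instance : Mul y.closure := ⟨fun a b => ⟨_, eval_elim_mem_closure y.map_mul a b⟩⟩
instance : Neg y.closure := ⟨fun a => ⟨_, eval_mem_closure a⟩⟩
instance : Zero y.closure := ⟨y.incl 0⟩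
instance : One y.closure := ⟨y.incl 1⟩

lemma incl_add (s t : R) : y.incl (s + t) = y.incl s + y.incl t :=
  Subtype.ext <| funext fun j => y.map_add s t j

lemma incl_mul (s t : R) : y.incl (s * t) = y.incl s * y.incl t :=
  Subtype.ext <| funext fun j => y.map_mul s t j

lemma incl_neg (t : R) : y.incl (-t) = -y.incl t :=
  Subtype.ext <| funext fun j => y.map_neg t j

lemma incl_zero : y.incl 0 = 0 := rfl

lemma incl_one : y.incl 1 = 1 := rfl

section

variable {X : Type*} {U : Subalgebra K (X → K)} {u v : X → y.closure}

lemma IsRegularTo.add (hu : y.IsRegularTo U u) (hv : y.IsRegularTo U v) :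
    y.IsRegularTo U fun x => u x + v x := fun j =>
  eval_mem_subalgebra U (u := fun x => Sum.elim (u x : Fin d → K) (v x : Fin d → K))
    (by rintro (c | c); exacts [hu c, hv c]) (y.addPoly j)

lemma IsRegularTo.mul (hu : y.IsRegularTo U u) (hv : y.IsRegularTo U v) :
    y.IsRegularTo U fun x => u x * v x := fun j =>
  eval_mem_subalgebra U (u := fun x => Sum.elim (u x : Fin d → K) (v x : Fin d → K))
    (by rintro (c | c); exacts [hu c, hv c]) (y.mulPoly j)

lemma IsRegularTo.neg (hu : y.IsRegularTo U u) : y.IsRegularTo U fun x => -u x := fun j =>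
  eval_mem_subalgebra U hu (y.negPoly j)

end

/-- Each axiom equates two regular maps on a power of the closure. It holds on the image of `R`,
which is dense in that power. -/
instance : CommRing y.closure := by
  have d1 := y.isDenseFor_incl
  have d2 := d1.prod d1
  have d3 := d1.prod d2
  have r1 : y.IsRegularTo y.regular id := isRegularTo_id
  have r2 := r1.fst y.regular
  have r2' := r1.snd y.regular
  have r3 := r1.fst (prodAlg y.regular y.regular)
  have r3' := r2.snd y.regular
  have r3'' := r2'.snd y.regular
  refine CommRing.ofMinimalAxioms ?_ ?_ ?_ ?_ ?_ ?_ ?_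
  · intro a b c
    refine ext_of_isDenseFor d3 ((r3.add r3').add r3'') (r3.add (r3'.add r3'')) ?_ (a, b, c)
    rintro ⟨r, s, t⟩
    simp [← incl_add, add_assoc]
  · intro a
    refine ext_of_isDenseFor d1 ((isRegularTo_const _ 0).add r1) r1 (fun t => ?_) a
    simp [← incl_add, ← incl_zero]
  · intro a
    refine ext_of_isDenseFor d1 (r1.neg.add r1) (isRegularTo_const _ 0) (fun t => ?_) a
    simp [← incl_add, ← incl_neg, ← incl_zero]
  · intro a b c
    refine ext_of_isDenseFor d3 ((r3.mul r3').mul r3'') (r3.mul (r3'.mul r3'')) ?_ (a, b, c)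
    rintro ⟨r, s, t⟩
    simp [← incl_mul, mul_assoc]
  · intro a b
    refine ext_of_isDenseFor d2 (r2.mul r2') (r2'.mul r2) ?_ (a, b)
    rintro ⟨s, t⟩
    simp [← incl_mul, mul_comm]
  · intro a
    refine ext_of_isDenseFor d1 ((isRegularTo_const _ 1).mul r1) r1 (fun t => ?_) a
    simp [← incl_mul, ← incl_one]
  · intro a b c
    refine ext_of_isDenseFor d3 (r3.mul (r3'.add r3'')) ((r3.mul r3').add (r3.mul r3'')) ?_
      (a, b, c)
    rintro ⟨r, s, t⟩
    simp [← incl_mul, ← incl_add, mul_add]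

variable (y)

/-- The closure of the image, as an algebraic ring. -/
def algebraicRing : CommAlgebraicRing K where
  ambientDim := d
  carrier := y.closure
  isClosed := by
    refine ⟨vanishingIdeal K (Set.range y.toFun), ?_⟩
    ext x
    simp [closure, zeroLocus, mem_vanishingIdeal_iff, aeval_eq_eval]
  commRing := inferInstance
  regular_add := ⟨y.addPoly, fun _ _ => rfl⟩
  regular_mul := ⟨y.mulPoly, fun _ _ => rfl⟩
  regular_neg := ⟨y.negPoly, fun _ _ => rfl⟩

/-- The parametrization as a homomorphism of rings. -/
def ringHom : R →+* y.algebraicRing.carrier where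
  toFun := y.incl
  map_one' := rfl
  map_zero' := rfl
  map_add' := incl_add
  map_mul' := incl_mul

lemma isZariskiDense_range : y.algebraicRing.IsZariskiDense (Set.range y.ringHom) :=
  fun p hp (x : y.closure) => x.2 p fun t => hp (y.incl t) (Set.mem_range_self (f := y.ringHom) t)

end RegularParametrization

/-! ### Maps to `GL_n` with coordinates in an algebra of functions -/

section CoordSubgroup

variable {K X Y : Type*} [Field K] {n : ℕ}

lemma glCoord_mul_inl (g h : GL (Fin n) K) (c : Fin n × Fin n) :
    glCoord (g * h) (Sum.inl c) =
      ∑ k, glCoord g (Sum.inl (c.1, k)) * glCoord h (Sum.inl (k, c.2)) := by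
  simp [glCoord, Matrix.mul_apply]

lemma glCoord_mul_inr (g h : GL (Fin n) K) (c : Fin n × Fin n) :
    glCoord (g * h) (Sum.inr c) =
      ∑ k, glCoord h (Sum.inr (c.1, k)) * glCoord g (Sum.inr (k, c.2)) := by
  simp [glCoord, Matrix.mul_apply, -Matrix.coe_units_inv]

lemma glCoord_inv (g : GL (Fin n) K) (c : GLCoord n) : glCoord g⁻¹ c = glCoord g c.swap := by
  rcases c with c | c <;> simp [glCoord]

lemma glCoord_injective : Function.Injective (glCoord : GL (Fin n) K → GLCoord n → K) := by
  intro g h e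
  ext a b
  exact congrFun e (Sum.inl (a, b))

lemma subalgebra_fun_sum_mem {τ : Type*} (S : Subalgebra K (X → K)) (s : Finset τ)
    {g : τ → X → K} (hg : ∀ k ∈ s, g k ∈ S) : (fun x => ∑ k ∈ s, g k x) ∈ S := by
  have := sum_mem hg
  convert this using 1
  funext x
  simp

/-- The group of the maps to `GL_n(K)` with all coordinates in the algebra of functions `S`. -/
def coordSubgroup (n : ℕ) (S : Subalgebra K (X → K)) : Subgroup (X → GL (Fin n) K) where
  carrier := {g | ∀ c, (fun x => glCoord (g x) c) ∈ S}
  mul_mem' := by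
    intro g h hg hh c
    rcases c with c | c
    · simp only [Pi.mul_apply, glCoord_mul_inl]
      exact subalgebra_fun_sum_mem S _ fun k _ => mul_mem (hg _) (hh _)
    · simp only [Pi.mul_apply, glCoord_mul_inr]
      exact subalgebra_fun_sum_mem S _ fun k _ => mul_mem (hh _) (hg _)
  one_mem' c := const_mem S (glCoord 1 c)
  inv_mem' := by
    intro g hg c
    simp only [Pi.inv_apply, glCoord_inv]
    exact hg _

lemma const_mem_coordSubgroup (S : Subalgebra K (X → K)) (g : GL (Fin n) K) :
    (fun _ => g) ∈ coordSubgroup n S := fun c => const_mem S (glCoord g c)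

/-- The algebra generated by the coordinates of a map to `GL_n(K)`. -/
abbrev coordAlg (g : X → GL (Fin n) K) : Subalgebra K (X → K) :=
  coordinateAlg fun x => glCoord (g x)

lemma mem_coordSubgroup_coordAlg (g : X → GL (Fin n) K) : g ∈ coordSubgroup n (coordAlg g) :=
  fun c => coordinate_mem (fun x => glCoord (g x)) c

lemma coordAlg_le_iff {g : X → GL (Fin n) K} {S : Subalgebra K (X → K)} :
    coordAlg g ≤ S ↔ g ∈ coordSubgroup n S :=
  ⟨fun h c => h (mem_coordSubgroup_coordAlg g c), fun h => coordinateAlg_le h⟩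

lemma comp_fst_mem_coordSubgroup {S : Subalgebra K (X → K)} (T : Subalgebra K (Y → K))
    {g : X → GL (Fin n) K} (hg : g ∈ coordSubgroup n S) :
    (fun p : X × Y => g p.1) ∈ coordSubgroup n (prodAlg S T) :=
  fun c => comp_fst_mem_prodAlg T (hg c)

lemma comp_snd_mem_coordSubgroup (S : Subalgebra K (X → K)) {T : Subalgebra K (Y → K)}
    {g : Y → GL (Fin n) K} (hg : g ∈ coordSubgroup n T) :
    (fun p : X × Y => g p.2) ∈ coordSubgroup n (prodAlg S T) :=
  fun c => comp_snd_mem_prodAlg S (hg c)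

lemma slice_left_mem_coordSubgroup {S : Subalgebra K (X → K)} {T : Subalgebra K (Y → K)}
    {g : X × Y → GL (Fin n) K} (hg : g ∈ coordSubgroup n (prodAlg S T)) (x : X) :
    (fun y => g (x, y)) ∈ coordSubgroup n T :=
  fun c => slice_left_mem (hg c) x

lemma slice_right_mem_coordSubgroup {S : Subalgebra K (X → K)} {T : Subalgebra K (Y → K)}
    {g : X × Y → GL (Fin n) K} (hg : g ∈ coordSubgroup n (prodAlg S T)) (y : Y) :
    (fun x => g (x, y)) ∈ coordSubgroup n S :=
  fun c => slice_right_mem (hg c) y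

end CoordSubgroup

/-! ### The algebraic ring attached to a family of one-parameter subgroups -/

section OneParameter

variable {R K : Type*} [CommRing R] [Field K] {n : ℕ}

/-- For a one-parameter subgroup `x` such that the coordinates of `x (s * t)` are polynomials in
those of `x s` and `x t`, the coordinates of `x` form a regular parametrization. -/
lemma exists_regularParametrization {x : R → GL (Fin n) K}
    (hadd : ∀ s t, x (s + t) = x s * x t) (hneg : ∀ t, x (-t) = (x t)⁻¹)
    (hmul : (fun p : R × R => x (p.1 * p.2)) ∈
      coordSubgroup n (prodAlg (coordAlg x) (coordAlg x))) :
    ∃ (d : ℕ) (y : RegularParametrization R K d), coordinateAlg y.toFun = coordAlg x := by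
  let e := Fintype.equivFin (GLCoord n)
  let y : R → Fin (Fintype.card (GLCoord n)) → K := fun t j => glCoord (x t) (e.symm j)
  have hy : coordinateAlg y = coordAlg x := by
    refine le_antisymm (coordinateAlg_le fun j => coordinate_mem (fun t => glCoord (x t)) _)
      (coordinateAlg_le fun c => ?_)
    simpa [y] using coordinate_mem y (e c)
  have hx := mem_coordSubgroup_coordAlg x
  have ha : (fun p : R × R => x (p.1 + p.2)) ∈
      coordSubgroup n (prodAlg (coordAlg x) (coordAlg x)) := by
    simp only [hadd]
    exact mul_mem (comp_fst_mem_coordSubgroup _ hx) (comp_snd_mem_coordSubgroup _ hx)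
  have hn : (fun t => x (-t)) ∈ coordSubgroup n (coordAlg x) := by
    simp only [hneg]
    exact inv_mem hx
  rw [← hy] at hmul ha hn
  choose A hA using fun j => exists_eval_of_mem_coordinateAlg
    (prodAlg_coordinateAlg_le _ _ (ha (e.symm j)))
  choose M hM using fun j => exists_eval_of_mem_coordinateAlg
    (prodAlg_coordinateAlg_le _ _ (hmul (e.symm j)))
  choose N hN using fun j => exists_eval_of_mem_coordinateAlg (hn (e.symm j))
  exact ⟨_, ⟨y, A, M, N, fun s t j => hA j (s, t), fun s t j => hM j (s, t),
    fun t j => hN j t⟩, hy⟩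

/-- Equality of the two algebras provides polynomials `F` and `Q` that express the coordinates of
`x` and of `y` through each other. The map `ψ` is given by `F`, and `Q` recovers the point from its
image. -/
lemma RegularParametrization.exists_regularMap {d : ℕ} (y : RegularParametrization R K d)
    {x : R → GL (Fin n) K} (hx : coordAlg x = coordinateAlg y.toFun) {Γ : Set (GL (Fin n) K)}
    (hΓ : ∀ t, x t ∈ Γ) :
    ∃ ψ : y.algebraicRing.carrier → glZariskiClosure Γ, Function.Injective ψ ∧
      IsRegularMap (fun a : y.algebraicRing.carrier => (a : Fin y.algebraicRing.ambientDim → K))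
        (fun a => glCoord ((ψ a : glZariskiClosure Γ) : GL (Fin n) K)) ∧
      ∀ t, x t = ψ (y.ringHom t) := by
  have hmem := mem_coordSubgroup_coordAlg x
  rw [hx] at hmem
  choose F hF using fun c => exists_eval_of_mem_coordinateAlg (hmem c)
  choose Q hQ using fun j => exists_eval_of_mem_coordinateAlg (hx ▸ coordinate_mem y.toFun j)
  have hreg : ∀ c, (fun a : y.closure => eval (a : Fin d → K) (F c)) ∈ y.regular :=
    fun c => eval_mem_subalgebra _ RegularParametrization.isRegularTo_id _
  have hval : ∀ t c, eval (y.incl t : Fin d → K) (F c) = glCoord (x t) c := fun t c => (hF c t).symm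
  -- Every polynomial relation among the coordinates of all `x t` persists on the closure. It is
  -- used below for the matrix identity `L * M = 1` and for the equations of the closure of `Γ`.
  have key : ∀ p : MvPolynomial (GLCoord n) K, (∀ t, eval (glCoord (x t)) p = 0) →
      ∀ a : y.closure, eval (fun c => eval (a : Fin d → K) (F c)) p = 0 := by
    intro p hp a
    refine congrFun (y.isDenseFor_incl _ (eval_mem_subalgebra _ hreg p) fun t => ?_) a
    simp only [hval, hp]
  let L : y.closure → Matrix (Fin n) (Fin n) K :=
    fun a => Matrix.of fun i j => eval (a : Fin d → K) (F (Sum.inl (i, j)))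
  let M : y.closure → Matrix (Fin n) (Fin n) K :=
    fun a => Matrix.of fun i j => eval (a : Fin d → K) (F (Sum.inr (i, j)))
  have hLM : ∀ a, L a * M a = 1 := by
    intro a
    ext i j
    have := key (∑ k, X (Sum.inl (i, k)) * X (Sum.inr (k, j)) -
      C ((1 : Matrix (Fin n) (Fin n) K) i j)) (fun t => ?_) a
    · simpa [L, M, Matrix.mul_apply, sub_eq_zero] using this
    · have h1 : ((x t : Matrix (Fin n) (Fin n) K) * ((x t)⁻¹ : GL (Fin n) K)) i j =
        (1 : Matrix (Fin n) (Fin n) K) i j := by rw [← Units.val_mul, mul_inv_cancel]; rfl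
      rw [Matrix.mul_apply] at h1
      simpa [glCoord, sub_eq_zero, -Matrix.coe_units_inv] using h1
  let ψ₀ : y.closure → GL (Fin n) K := fun a =>
    ⟨L a, M a, hLM a, mul_eq_one_comm.1 (hLM a)⟩
  have hψ : ∀ a, glCoord (ψ₀ a) = fun c => eval (a : Fin d → K) (F c) := by
    intro a
    funext c
    rcases c with c | c <;> rfl
  have hcl : ∀ a, ψ₀ a ∈ glZariskiClosure Γ := by
    intro a p hp
    rw [hψ, aeval_eq_eval]
    exact key p (fun t => by simpa [aeval_eq_eval] using hp _ (hΓ t)) a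
  refine ⟨fun a => ⟨ψ₀ a, hcl a⟩, ?_, ⟨F, fun a c => ?_⟩, fun t => ?_⟩
  · intro a b hab
    have hab' : glCoord (ψ₀ a) = glCoord (ψ₀ b) :=
      congrArg (fun z : glZariskiClosure Γ => glCoord (z : GL (Fin n) K)) hab
    -- `Q` composed with `F` is the identity on the image of `R`, hence on its closure.
    have hinv : ∀ (a : y.closure) j, eval (glCoord (ψ₀ a)) (Q j) = (a : Fin d → K) j := by
      intro a j
      have h1 : (fun a : y.closure => eval (glCoord (ψ₀ a)) (Q j)) ∈ y.regular :=
        eval_mem_subalgebra _ (fun c => by simpa only [hψ] using hreg c) _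
      refine congrFun (y.isDenseFor_incl.eq h1 (RegularParametrization.isRegularTo_id j)
        fun t => ?_) a
      simp only [hψ, hval]
      exact (hQ j t).symm
    exact Subtype.ext (funext fun j => by rw [← hinv a j, ← hinv b j, hab'])
  · exact congrFun (hψ a) c
  · refine glCoord_injective ?_
    refine Eq.trans ?_ (hψ (y.incl t)).symm
    funext c
    exact (hval t c).symm

/-! ### Families of one-parameter subgroups linked by multiplications -/

section Family

variable {ι : Type*} {x : ι → R → GL (Fin n) K}

/-- The coordinates of `x_k(c s t)`, for some unit `c`, are polynomials in the coordinates of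
`x_i(s)` and `x_j(t)`. -/
def HasMul (x : ι → R → GL (Fin n) K) (i j k : ι) : Prop :=
  ∃ c : R, IsUnit c ∧ (fun p : R × R => x k (c * p.1 * p.2)) ∈
    coordSubgroup n (prodAlg (coordAlg (x i)) (coordAlg (x j)))

/-- Putting the second variable equal to `c⁻¹` turns `x k (c * s * t)` into `x k s`, while the
coordinates of `x j` become constants. -/
lemma HasMul.le_left {i j k : ι} (h : HasMul x i j k) : coordAlg (x k) ≤ coordAlg (x i) := by
  obtain ⟨_, ⟨c, rfl⟩, h⟩ := h
  rw [coordAlg_le_iff]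
  have := slice_right_mem_coordSubgroup h (↑c⁻¹ : R)
  simpa only [mul_right_comm _ _ (↑c⁻¹ : R), Units.mul_inv, one_mul] using this

lemma HasMul.le_right {i j k : ι} (h : HasMul x i j k) : coordAlg (x k) ≤ coordAlg (x j) := by
  obtain ⟨_, ⟨c, rfl⟩, h⟩ := h
  rw [coordAlg_le_iff]
  have := slice_left_mem_coordSubgroup h (↑c⁻¹ : R)
  simpa using this

/-- The factor `c` is replaced by any `u` through the substitution of `c⁻¹ * u * s` for `s`. This
substitution preserves the common algebra, again by fixing a variable. -/
lemma HasMul.mul_mem {i j k : ι} (h : HasMul x i j k) (hi : coordAlg (x i) = coordAlg (x k))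
    (hj : coordAlg (x j) = coordAlg (x k)) (u : R) :
    (fun p : R × R => x k (u * p.1 * p.2)) ∈
      coordSubgroup n (prodAlg (coordAlg (x k)) (coordAlg (x k))) := by
  obtain ⟨_, ⟨c, rfl⟩, h⟩ := h
  rw [hi, hj] at h
  have hscale : ∀ g ∈ coordAlg (x k), (fun s => g (↑c⁻¹ * u * s)) ∈ coordAlg (x k) := by
    have hv : ∀ v, (fun t => x k (v * t)) ∈ coordSubgroup n (coordAlg (x k)) := fun v => by
      have := slice_left_mem_coordSubgroup h (↑c⁻¹ * v)
      simpa [← mul_assoc] using this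
    have : coordAlg (x k) ≤ (coordAlg (x k)).comap (pullback K fun s => (↑c⁻¹ * u : R) * s) :=
      coordinateAlg_le fun d => hv _ d
    exact fun g hg => this hg
  intro d
  have := comp_mem_of_mem_prodAlg
    (U := prodAlg (coordAlg (x k)) (coordAlg (x k)))
    (φ := fun p : R × R => (↑c⁻¹ * u : R) * p.1) (χ := Prod.snd)
    (fun g hg => comp_fst_mem_prodAlg _ (hscale g hg)) (fun g hg => comp_snd_mem_prodAlg _ hg) (h d)
  simpa [← mul_assoc] using this

/-- This is the multiplication restricted to the diagonal. It serves the factor quadratic in `t` in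
the conjugation relation of type `G₂`. -/
lemma HasMul.sq_mem {i j k : ι} (h : HasMul x i j k) (hi : coordAlg (x i) = coordAlg (x k))
    (hj : coordAlg (x j) = coordAlg (x k)) (u : R) :
    (fun t => x k (u * t ^ 2)) ∈ coordSubgroup n (coordAlg (x k)) := by
  intro d
  have := comp_mem_of_mem_prodAlg (φ := id) (χ := id) (fun g hg => hg) (fun g hg => hg)
    (h.mul_mem hi hj u d)
  simpa [pow_two, ← mul_assoc] using this

lemma HasMul.smul_mem {i j k : ι} (h : HasMul x i j k) (hi : coordAlg (x i) = coordAlg (x k))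
    (hj : coordAlg (x j) = coordAlg (x k)) (u : R) :
    (fun t => x k (u * t)) ∈ coordSubgroup n (coordAlg (x k)) := by
  have := slice_left_mem_coordSubgroup (h.mul_mem hi hj u) 1
  simpa using this

/-- A family of one-parameter subgroups with the same coordinate algebra, one of which admits a
multiplication, comes from an algebraic ring. -/
theorem exists_algebraicRing (hadd : ∀ i s t, x i (s + t) = x i s * x i t)
    (heq : ∀ i j, coordAlg (x i) = coordAlg (x j)) {i j k : ι} (hmul : HasMul x i j k)
    {Γ : Set (GL (Fin n) K)} (hΓ : ∀ i t, x i t ∈ Γ) :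
    ∃ (A : CommAlgebraicRing K) (f : R →+* A.carrier), A.IsZariskiDense (Set.range f) ∧
      ∀ α : ι, ∃ ψ : A.carrier → glZariskiClosure Γ, Function.Injective ψ ∧
        IsRegularMap (fun a : A.carrier => (a : Fin A.ambientDim → K))
          (fun a => glCoord ((ψ a : glZariskiClosure Γ) : GL (Fin n) K)) ∧
        ∀ t : R, x α t = ψ (f t) := by
  have hzero : ∀ i, x i 0 = 1 := fun i => by simpa using hadd i 0 0
  have hneg : ∀ i t, x i (-t) = (x i t)⁻¹ := fun i t =>
    eq_inv_of_mul_eq_one_left (by rw [← hadd, neg_add_cancel, hzero])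
  have hmul' := hmul.mul_mem (heq i k) (heq j k) 1
  simp only [one_mul] at hmul'
  -- The ring is built from the single index `k`. Since all coordinate algebras agree, it serves
  -- every other index too.
  obtain ⟨d, y, hy⟩ := exists_regularParametrization (hadd k) (hneg k) hmul'
  exact ⟨y.algebraicRing, y.ringHom, y.isZariskiDense_range, fun α =>
    y.exists_regularMap ((heq α k).trans hy.symm) (hΓ α)⟩

end Family

end OneParameter

/-! ### Exponentials in a complex Banach algebra -/

section Exponential

open NormedSpace

variable {𝔸 : Type*} [NormedRing 𝔸] [NormedAlgebra ℂ 𝔸] [CompleteSpace 𝔸]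

lemma exp_mul_exp_neg (a : 𝔸) : exp a * exp (-a) = 1 := by
  let _ := NormedAlgebra.restrictScalars ℚ ℂ 𝔸
  rw [← exp_add_of_commute (Commute.neg_right (Commute.refl a)), add_neg_cancel, exp_zero]

lemma exp_add_of_commute' {a b : 𝔸} (h : Commute a b) : exp (a + b) = exp a * exp b := by
  let _ := NormedAlgebra.restrictScalars ℚ ℂ 𝔸
  exact exp_add_of_commute h

omit [CompleteSpace 𝔸] in
lemma eq_of_hasDerivAt_zero {F : ℂ → 𝔸} (h : ∀ t, HasDerivAt F 0 t) (t : ℂ) :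
    F t = F 0 :=
  is_const_of_deriv_eq_zero (fun s => (h s).differentiableAt) (fun s => (h s).deriv) t 0

/-- Conjugation by `exp (s a)` on a chain `y₀, y₁ = [a, y₀], y₂, y₃` with `[a, y₃] = 0`. -/
lemma exp_smul_mul_eq_of_chain {a y₀ y₁ y₂ y₃ : 𝔸} (h₀ : a * y₀ - y₀ * a = y₁)
    (h₁ : a * y₁ - y₁ * a = y₂) (h₂ : a * y₂ - y₂ * a = y₃) (h₃ : a * y₃ - y₃ * a = 0) (s : ℂ) :
    exp (s • a) * y₀ =
      (y₀ + s • y₁ + (s ^ 2 / 2) • y₂ + (s ^ 3 / 6) • y₃) * exp (s • a) := by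
  -- The polynomial `p` is `exp (s ad a)` applied to `y₀`, which stops in degree three because `[a,
  -- y₃] = 0`. It satisfies `p' = [a, p]`, so `exp (-s a) p(s) exp (s a)` has derivative zero.
  let p : ℂ → 𝔸 := fun s => y₀ + s • y₁ + (s ^ 2 / 2) • y₂ + (s ^ 3 / 6) • y₃
  have hp : ∀ s, HasDerivAt p (y₁ + s • y₂ + (s ^ 2 / 2) • y₃) s := by
    intro s
    have d1 : HasDerivAt (fun s : ℂ => s • y₁) ((1 : ℂ) • y₁) s := (hasDerivAt_id s).smul_const y₁
    have d2 : HasDerivAt (fun s : ℂ => (s ^ 2 / 2) • y₂) (s • y₂) s := by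
      convert! (((hasDerivAt_id s).pow 2).div_const 2).smul_const y₂ using 2
      simp
    have d3 : HasDerivAt (fun s : ℂ => (s ^ 3 / 6) • y₃) ((s ^ 2 / 2) • y₃) s := by
      convert! (((hasDerivAt_id s).pow 3).div_const 6).smul_const y₃ using 2
      simp
      ring
    convert! (((hasDerivAt_const s y₀).add d1).add d2).add d3 using 1
    simp
  have hF : ∀ s, HasDerivAt (fun s : ℂ => exp (s • (-a)) * p s * exp (s • a)) 0 s := by
    intro s
    convert! ((hasDerivAt_exp_smul_const (-a) s).mul (hp s)).mul
      (hasDerivAt_exp_smul_const' a s) using 1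
    have e : y₁ + s • y₂ + (s ^ 2 / 2) • y₃ = a * p s - p s * a := by
      have e4 : a * p s - p s * a = (a * y₀ - y₀ * a) + s • (a * y₁ - y₁ * a)
          + (s ^ 2 / 2) • (a * y₂ - y₂ * a) + (s ^ 3 / 6) • (a * y₃ - y₃ * a) := by
        simp only [p, mul_add, add_mul, mul_smul_comm, smul_mul_assoc, smul_sub]
        abel
      rw [e4, h₀, h₁, h₂, h₃]
      simp
    simp only [Pi.mul_apply]
    rw [e]
    noncomm_ring
  have h := eq_of_hasDerivAt_zero hF s
  have h' : exp (-(s • a)) * p s * exp (s • a) = y₀ := by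
    simpa [p] using h
  calc exp (s • a) * y₀ = exp (s • a) * (exp (-(s • a)) * p s * exp (s • a)) := by rw [h']
    _ = p s * exp (s • a) := by rw [← mul_assoc, ← mul_assoc, exp_mul_exp_neg, one_mul]

/-- The Baker–Campbell–Hausdorff formula when the commutator is central. -/
lemma exp_add_of_commute_commutator {a b c : 𝔸} (hc : a * b - b * a = c) (ha : Commute a c)
    (hb : Commute b c) : exp (a + b) = exp a * exp b * exp (-((1 / 2 : ℂ) • c)) := by
  -- The quotient of the two sides for `t a` and `t b` is constant. The commutator is then `t² c`,
  -- whence the factor `t² / 2`.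
  have hF : ∀ t, HasDerivAt (fun t : ℂ => exp (t • a) * exp (t • b) * exp ((t ^ 2 / 2) • (-c)) *
      exp (t • (-(a + b)))) 0 t := by
    intro t
    have dz : HasDerivAt (fun t : ℂ => exp ((t ^ 2 / 2) • (-c)))
        (t • (-c * exp ((t ^ 2 / 2) • (-c)))) t := by
      have := HasDerivAt.scomp (h := fun t : ℂ => t ^ 2 / 2) t
        (hasDerivAt_exp_smul_const' (-c) (t ^ 2 / 2)) (((hasDerivAt_id t).pow 2).div_const 2)
      convert! this using 2
      simp
    convert! (((hasDerivAt_exp_smul_const a t).mul (hasDerivAt_exp_smul_const' b t)).mul dz).mul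
      (hasDerivAt_exp_smul_const' (-(a + b)) t) using 1
    have e1 : a * exp (t • b) = exp (t • b) * (a + t • c) := by
      have h1 := exp_smul_mul_eq_of_chain (a := b) (y₀ := a) (y₁ := -c) (y₂ := 0) (y₃ := 0)
        (by rw [← hc]; abel) (by simp [hb.eq]) (by simp) (by simp) t
      have h2 : exp (t • b) * c = c * exp (t • b) :=
        ((hb.smul_left t).exp_left).eq
      rw [mul_add, h1, mul_smul_comm, h2]
      simp [add_mul]
    set u := exp (t • a)
    set v := exp (t • b)
    have hwc : Commute (a + b) (exp ((t ^ 2 / 2) • (-c))) :=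
      (((ha.add_left hb).neg_right).smul_right _).exp_right
    have hvb : b * v = v * b := ((Commute.refl b).smul_right t).exp_right.eq
    set w := exp ((t ^ 2 / 2) • (-c))
    set z := exp (t • (-(a + b)))
    have e2 : u * v * w * (-(a + b) * z) = -(u * v * ((a + b) * w) * z) := by
      rw [hwc.eq]; noncomm_ring
    simp only [Pi.mul_apply]
    change 0 = ((u * a * v + u * (b * v)) * w + u * v * t • (-c * w)) * z +
      u * v * w * (-(a + b) * z)
    rw [e2, mul_assoc u a v, e1, hvb]
    simp only [mul_add, add_mul, mul_smul_comm, smul_mul_assoc, neg_mul, mul_neg, smul_neg,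
      ← mul_assoc]
    abel
  have h := eq_of_hasDerivAt_zero hF 1
  simp only [zero_smul, exp_zero, one_smul, mul_one, ne_eq, OfNat.ofNat_ne_zero,
    not_false_eq_true, zero_pow, zero_div, one_pow] at h
  have h2 : exp (-(a + b)) * exp (a + b) = 1 := by
    simpa using exp_mul_exp_neg (-(a + b))
  calc exp (a + b) = (exp a * exp b * exp ((1 / 2 : ℂ) • (-c)) * exp (-(a + b))) * exp (a + b) := by
        rw [h, one_mul]
    _ = _ := by rw [mul_assoc _ (exp (-(a + b))), h2, mul_one, smul_neg]

/-- The conjugate of `exp (t y₀)` by `exp (s a)` for a chain `y₀, …, y₃` as above, if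
`[y₀, y₃]` and `[y₁, y₂]` are central and the other commutators vanish. -/
lemma exp_conj_eq_of_chain {a y₀ y₁ y₂ y₃ z : 𝔸} (h₀ : a * y₀ - y₀ * a = y₁)
    (h₁ : a * y₁ - y₁ * a = y₂) (h₂ : a * y₂ - y₂ * a = y₃) (h₃ : a * y₃ - y₃ * a = 0)
    (h01 : Commute y₀ y₁) (h02 : Commute y₀ y₂) (h13 : Commute y₁ y₃) (h23 : Commute y₂ y₃)
    {q r : ℂ} (h03 : y₀ * y₃ - y₃ * y₀ = q • z) (h12 : y₁ * y₂ - y₂ * y₁ = r • z)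
    (hz₀ : Commute y₀ z) (hz₁ : Commute y₁ z) (hz₂ : Commute y₂ z) (hz₃ : Commute y₃ z) (s t : ℂ) :
    exp (s • a) * exp (t • y₀) * exp (-(s • a)) =
      exp (t • y₀) * exp ((s * t) • y₁) * exp ((s ^ 2 * t / 2) • y₂) *
        exp ((s ^ 3 * t / 6) • y₃) * exp (-((s ^ 3 * t ^ 2 * (q / 12 + r / 4)) • z)) := by
  have hconj : exp (s • a) * exp (t • y₀) * exp (-(s • a)) =
      exp (t • (y₀ + s • y₁ + (s ^ 2 / 2) • y₂ + (s ^ 3 / 6) • y₃)) := by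
    let _ := NormedAlgebra.restrictScalars ℚ ℂ 𝔸
    let u : 𝔸ˣ := ⟨exp (s • a), exp (-(s • a)), exp_mul_exp_neg _, by
      simpa using exp_mul_exp_neg (-(s • a))⟩
    have := exp_units_conj u (t • y₀)
    change _ = exp (s • a) * exp (t • y₀) * exp (-(s • a)) at this
    rw [← this]
    congr 1
    change exp (s • a) * (t • y₀) * exp (-(s • a)) = _
    rw [mul_smul_comm, smul_mul_assoc, exp_smul_mul_eq_of_chain h₀ h₁ h₂ h₃, mul_assoc,
      exp_mul_exp_neg, mul_one]
  -- The exponent is split into two halves, each a sum of two commuting terms. Their commutator is a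
  -- multiple of `z`, so the Baker–Campbell–Hausdorff formula ends after its first correction.
  let A := t • y₀ + (s * t) • y₁
  let B := (s ^ 2 * t / 2) • y₂ + (s ^ 3 * t / 6) • y₃
  have hAB : t • (y₀ + s • y₁ + (s ^ 2 / 2) • y₂ + (s ^ 3 / 6) • y₃) = A + B := by
    simp only [A, B]
    module
  have hcomm : A * B - B * A = (2 * (s ^ 3 * t ^ 2 * (q / 12 + r / 4))) • z := by
    have e : A * B - B * A = (s ^ 2 * t ^ 2 / 2) • (y₀ * y₂ - y₂ * y₀) +
        (s ^ 3 * t ^ 2 / 6) • (y₀ * y₃ - y₃ * y₀) + (s ^ 3 * t ^ 2 / 2) • (y₁ * y₂ - y₂ * y₁) +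
        (s ^ 4 * t ^ 2 / 6) • (y₁ * y₃ - y₃ * y₁) := by
      simp only [A, B, mul_add, add_mul, smul_mul_smul_comm]
      module
    rw [e, h03, h12, h02.eq, h13.eq, sub_self, sub_self]
    module
  have hA : exp A = exp (t • y₀) * exp ((s * t) • y₁) :=
    exp_add_of_commute' ((h01.smul_left _).smul_right _)
  have hB : exp B = exp ((s ^ 2 * t / 2) • y₂) * exp ((s ^ 3 * t / 6) • y₃) :=
    exp_add_of_commute' ((h23.smul_left _).smul_right _)
  rw [hconj, hAB, exp_add_of_commute_commutator hcomm
    ((((hz₀.smul_left _).add_left (hz₁.smul_left _))).smul_right _)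
    ((((hz₂.smul_left _).add_left (hz₃.smul_left _))).smul_right _), hA, hB, smul_smul]
  simp only [mul_assoc]
  congr 7
  ring

end Exponential

/-- Any Banach algebra norm compatible with the topology of matrices serves, since the statement
involves no norm. -/
lemma matrix_exp_conj_eq_of_chain {N : ℕ} {a y₀ y₁ y₂ y₃ z : Matrix (Fin N) (Fin N) ℂ}
    (h₀ : a * y₀ - y₀ * a = y₁) (h₁ : a * y₁ - y₁ * a = y₂) (h₂ : a * y₂ - y₂ * a = y₃)
    (h₃ : a * y₃ - y₃ * a = 0)
    (h01 : Commute y₀ y₁) (h02 : Commute y₀ y₂) (h13 : Commute y₁ y₃) (h23 : Commute y₂ y₃)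
    {q r : ℂ} (h03 : y₀ * y₃ - y₃ * y₀ = q • z) (h12 : y₁ * y₂ - y₂ * y₁ = r • z)
    (hz₀ : Commute y₀ z) (hz₁ : Commute y₁ z) (hz₂ : Commute y₂ z) (hz₃ : Commute y₃ z) (s t : ℂ) :
    NormedSpace.exp (s • a) * NormedSpace.exp (t • y₀) * NormedSpace.exp (-(s • a)) =
      NormedSpace.exp (t • y₀) * NormedSpace.exp ((s * t) • y₁) *
        NormedSpace.exp ((s ^ 2 * t / 2) • y₂) * NormedSpace.exp ((s ^ 3 * t / 6) • y₃) *
        NormedSpace.exp (-((s ^ 3 * t ^ 2 * (q / 12 + r / 4)) • z)) := by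
  let _ : NormedRing (Matrix (Fin N) (Fin N) ℂ) := Matrix.linftyOpNormedRing
  let _ : NormedAlgebra ℂ (Matrix (Fin N) (Fin N) ℂ) := Matrix.linftyOpNormedAlgebra
  exact exp_conj_eq_of_chain h₀ h₁ h₂ h₃ h01 h02 h13 h23 h03 h12 hz₀ hz₁ hz₂ hz₃ s t

lemma intEval_X {σ S : Type*} [CommRing S] (x : σ → S) (c : σ) : intEval x (X c) = x c := by
  simp [intEval]

/-! ### Commutators of root vectors -/

section RootVectors

variable {ι V W : Type*} [Finite ι] [AddCommGroup V] [Module ℝ V] [AddCommGroup W] [Module ℝ W]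
  {P : RootPairing ι ℝ V W} [P.IsCrystallographic]
  {L : Type*} [LieRing L] [LieAlgebra ℂ L] [FiniteDimensional ℂ L] [LieAlgebra.IsKilling ℂ L]
  {H : LieSubalgebra ℂ L} [H.IsCartanSubalgebra]

omit [Finite ι] [P.IsCrystallographic] in
lemma eq_zero_of_forall_pairing [P.IsRootSystem] {v : V} (h : ∀ l, P.coroot' l v = 0) : v = 0 :=
  (P.eq_zero_iff_forall_coroot'_eq_zero (x := v)).2 h

namespace ChevalleyBasis

variable (B : ChevalleyBasis P H)

lemma weight_apply_coroot (i j : ι) :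
    (B.index i : LieModule.Weight ℂ H L) (coroot (B.index j : LieModule.Weight ℂ H L)) =
      ((P.pairingIn ℤ i j : ℤ) : ℂ) := by
  rw [← B.pairing_index i j, ← rootSystem_pairing_apply,
    ← (rootSystem H).algebraMap_pairingIn ℤ]
  simp

/-- If two root vectors do not commute, the sum of the roots is zero or a root. -/
lemma add_mem_range_of_lie_ne_zero [P.IsRootSystem] {i j : ι} (h : ⁅B.vec i, B.vec j⁆ ≠ 0)
    (h0 : P.root i + P.root j ≠ 0) : P.root i + P.root j ∈ Set.range P.root := by
  have hmem := lie_mem_genWeightSpace_of_mem_genWeightSpace (B.vec_mem i) (B.vec_mem j)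
  have hpair : ∀ l, P.coroot' l (P.root i + P.root j) =
      ((P.pairingIn ℤ i l + P.pairingIn ℤ j l : ℤ) : ℝ) := by
    intro l
    rw [map_add, P.root_coroot'_eq_pairing, P.root_coroot'_eq_pairing,
      ← P.algebraMap_pairingIn ℤ, ← P.algebraMap_pairingIn ℤ]
    simp
  -- The bracket is a nonzero vector in the space of the sum of the two weights, so this sum is a
  -- weight.
  let χ : LieModule.Weight ℂ H L :=
    { toFun := (B.index i : LieModule.Weight ℂ H L) + (B.index j : LieModule.Weight ℂ H L)
      genWeightSpace_ne_bot' := by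
        intro hbot
        rw [hbot] at hmem
        exact h ((LieSubmodule.mem_bot _).1 hmem) }
  have hχ : ∀ l, χ (coroot (B.index l : LieModule.Weight ℂ H L)) =
      ((P.pairingIn ℤ i l + P.pairingIn ℤ j l : ℤ) : ℂ) := by
    intro l
    rw [Int.cast_add, ← B.weight_apply_coroot, ← B.weight_apply_coroot]
    rfl
  by_cases hz : χ.IsZero
  · refine absurd (eq_zero_of_forall_pairing (P := P) fun l => ?_) h0
    have h1 := hχ l
    rw [hz.eq, Pi.zero_apply] at h1
    rw [hpair, Int.cast_eq_zero]
    exact_mod_cast h1.symm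
  · obtain ⟨k, hk⟩ := B.index.surjective ⟨χ, by simpa using hz⟩
    -- The two root systems are related only by their Cartan integers. These suffice, because a
    -- vector of `V` is determined by its pairings with all coroots.
    refine ⟨k, sub_eq_zero.1 (eq_zero_of_forall_pairing (P := P) fun l => ?_)⟩
    have h1 := B.weight_apply_coroot k l
    rw [hk, hχ] at h1
    rw [map_sub, hpair, P.root_coroot'_eq_pairing, ← P.algebraMap_pairingIn ℤ, sub_eq_zero]
    have h2 : P.pairingIn ℤ i l + P.pairingIn ℤ j l = P.pairingIn ℤ k l := by exact_mod_cast h1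
    rw [h2]
    simp

end ChevalleyBasis

namespace UniversalLattice

variable {B : ChevalleyBasis P H} {N : ℕ} (C : UniversalLattice B N)

lemma commute_rep [P.IsRootSystem] {i j : ι} (h0 : P.root i + P.root j ≠ 0)
    (h : P.root i + P.root j ∉ Set.range P.root) :
    Commute (C.rep (B.vec i)) (C.rep (B.vec j)) := by
  have h1 : ⁅B.vec i, B.vec j⁆ = 0 := by
    by_contra hne
    exact h (B.add_mem_range_of_lie_ne_zero hne h0)
  have h2 := C.rep_lie (B.vec i) (B.vec j)
  rw [h1, map_zero] at h2
  exact sub_eq_zero.1 h2.symm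

/-- The undetermined sign of a structure constant is absorbed in `m`. Only its absolute value
matters, for deciding when `m` is a unit. -/
lemma exists_rep_commutator {i j k : ι} (h : P.root k = P.root i + P.root j) :
    ∃ m : ℤ, m.natAbs = P.chainBotCoeff i j + 1 ∧
      C.rep (B.vec i) * C.rep (B.vec j) - C.rep (B.vec j) * C.rep (B.vec i) =
        (m : ℂ) • C.rep (B.vec k) := by
  rcases B.lie_vec_add i j k h with h1 | h1
  · refine ⟨(P.chainBotCoeff i j + 1 : ℕ), Int.natAbs_natCast _, ?_⟩
    rw [← C.rep_lie, h1, map_nsmul, Int.cast_natCast, Nat.cast_smul_eq_nsmul]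
  · refine ⟨-(P.chainBotCoeff i j + 1 : ℕ), by rw [Int.natAbs_neg, Int.natAbs_natCast], ?_⟩
    rw [← C.rep_lie, h1, map_neg, map_nsmul, Int.cast_neg, Int.cast_natCast, neg_smul,
      Nat.cast_smul_eq_nsmul]

/-- The exponential series is finite, as `x_α ^ N = 0`. This brings the analytic identities to bear
on the root elements over `ℂ`. -/
lemma rootMatrix_eq_exp (i : ι) (t : ℂ) :
    C.rootMatrix i t = NormedSpace.exp (t • C.rep (B.vec i)) := by
  rw [NormedSpace.exp_eq_tsum ℂ, rootMatrix]
  dsimp only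
  rw [tsum_eq_sum (s := Finset.range N)]
  · refine Finset.sum_congr rfl fun k _ => ?_
    rw [C.map_divPow, smul_pow, smul_comm]
  · intro k hk
    rw [smul_pow, pow_eq_zero_of_le (by simpa using hk) (C.rep_pow_eq_zero i), smul_zero,
      smul_zero]

/-- A polynomial with integral coefficients is determined by its values at complex points. -/
lemma generalLinear_ext_of_complex {σ : Type*} {g h : GL (Fin N) (MvPolynomial σ ℤ)}
    (hgh : ∀ x : σ → ℂ, Matrix.GeneralLinearGroup.map (intEval x) g =
      Matrix.GeneralLinearGroup.map (intEval x) h) : g = h := by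
  ext a b : 2
  apply MvPolynomial.map_injective (Int.castRingHom ℂ) (RingHom.injective_int _)
  refine MvPolynomial.funext fun x => ?_
  rw [MvPolynomial.eval_map, MvPolynomial.eval_map]
  have := congrArg (fun z : GL (Fin N) ℂ => (z : Matrix (Fin N) (Fin N) ℂ) a b) (hgh x)
  simpa [intEval] using this

/-- An identity between elements of `GL_N(ℤ[s, t])` that holds over the complex numbers. -/
lemma generalLinear_map_eq_of_complex {S : Type*} [CommRing S]
    (g h : GL (Fin N) (MvPolynomial (Fin 2) ℤ))
    (hgh : ∀ s t : ℂ, Matrix.GeneralLinearGroup.map (intEval ![s, t]) g =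
      Matrix.GeneralLinearGroup.map (intEval ![s, t]) h) (s t : S) :
    Matrix.GeneralLinearGroup.map (intEval ![s, t]) g =
      Matrix.GeneralLinearGroup.map (intEval ![s, t]) h := by
  rw [generalLinear_ext_of_complex (g := g) (h := h) fun x => ?_]
  have : x = ![x 0, x 1] := by
    funext k
    fin_cases k <;> rfl
  rw [this]
  exact hgh _ _

/-! ### Conjugation relations between root elements over a commutative ring -/

section Relations

variable [P.IsRootSystem] {S : Type*} [CommRing S]

omit [Finite ι] [P.IsCrystallographic] [P.IsRootSystem] in
lemma zsmul_add_zsmul_ne_zero {i j : ι} (hli : LinearIndependent ℝ ![P.root i, P.root j])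
    {a b : ℤ} (hab : a ≠ 0 ∨ b ≠ 0) : a • P.root i + b • P.root j ≠ 0 := by
  intro h
  have := LinearIndependent.pair_iff.1 hli (a : ℝ) (b : ℝ) (by simpa [Int.cast_smul_eq_zsmul] using h)
  simp only [Int.cast_eq_zero] at this
  tauto

lemma commute_rep_of_eq {i j u v : ι} (hli : LinearIndependent ℝ ![P.root i, P.root j])
    {a b c d : ℤ} (hu : P.root u = a • P.root i + b • P.root j)
    (hv : P.root v = c • P.root i + d • P.root j) (h0 : a + c ≠ 0 ∨ b + d ≠ 0)
    (h : (a + c) • P.root i + (b + d) • P.root j ∉ Set.range P.root) :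
    Commute (C.rep (B.vec u)) (C.rep (B.vec v)) := by
  have e : P.root u + P.root v = (a + c) • P.root i + (b + d) • P.root j := by
    rw [hu, hv]; module
  exact C.commute_rep (e ▸ zsmul_add_zsmul_ne_zero hli h0) (e ▸ h)

/-- The commutator relation for roots `i, j` such that `i + j` is the only root of the form
`a i + b j` with `a, b > 0`. -/
theorem rootGL_conj_of_simple {i j k : ι} (hk : P.root k = P.root i + P.root j)
    (hli : LinearIndependent ℝ ![P.root i, P.root j])
    (h21 : (2 : ℤ) • P.root i + (1 : ℤ) • P.root j ∉ Set.range P.root)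
    (h12 : (1 : ℤ) • P.root i + (2 : ℤ) • P.root j ∉ Set.range P.root) :
    ∃ m : ℤ, m.natAbs = P.chainBotCoeff i j + 1 ∧ ∀ s t : S,
      C.rootGL i s * C.rootGL j t * (C.rootGL i s)⁻¹ =
        C.rootGL j t * C.rootGL k ((m : S) * s * t) := by
  obtain ⟨m, hm, hb⟩ := C.exists_rep_commutator hk
  refine ⟨m, hm, fun s t => ?_⟩
  have hi : P.root i = (1 : ℤ) • P.root i + (0 : ℤ) • P.root j := by module
  have hj : P.root j = (0 : ℤ) • P.root i + (1 : ℤ) • P.root j := by module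
  have hk' : P.root k = (1 : ℤ) • P.root i + (1 : ℤ) • P.root j := by rw [hk]; module
  have cik := C.commute_rep_of_eq hli hi hk' (by decide) h21
  have cjk := C.commute_rep_of_eq hli hj hk' (by decide) h12
  have key := generalLinear_map_eq_of_complex
    (C.rootGL i (X 0) * C.rootGL j (X 1) * (C.rootGL i (X 0))⁻¹)
    (C.rootGL j (X 1) * C.rootGL k ((m : MvPolynomial (Fin 2) ℤ) * X 0 * X 1)) ?_ s t
  · simpa [C.rootGL_map, intEval_X] using key
  · intro s t
    simp only [map_mul, C.rootGL_map, map_intCast, C.rootGL_inv, map_neg, intEval_X]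
    apply Units.ext
    simp only [Units.val_mul, rootGL, C.rootMatrix_eq_exp, Matrix.cons_val_zero, neg_smul,
      Matrix.cons_val_one, Matrix.cons_val_fin_one]
    -- The chain starting at `x_j` stops after `[x_i, x_j] = m x_k`.
    have := matrix_exp_conj_eq_of_chain (y₂ := 0) (y₃ := 0) (z := 0) (q := 0) (r := 0) hb
      (sub_eq_zero.2 (cik.smul_right _).eq) (by simp) (by simp) (cjk.smul_right _)
      (.zero_right _) (.zero_right _) (.zero_right _) (by simp) (by simp) (.zero_right _)
      (.zero_right _) (.zero_right _) (.zero_right _) s t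
    rw [this]
    simp only [smul_zero, neg_zero, NormedSpace.exp_zero, mul_one, smul_smul]
    congr 3
    ring

/-- The conjugation relation for roots `i, j` such that `i + j` and `2 i + j` are the only roots of
the form `a i + b j` with `a, b > 0`. -/
theorem rootGL_conj_of_double {i j k l : ι} (hk : P.root k = P.root i + P.root j)
    (hl : P.root l = P.root i + P.root k)
    (hli : LinearIndependent ℝ ![P.root i, P.root j])
    (h12 : (1 : ℤ) • P.root i + (2 : ℤ) • P.root j ∉ Set.range P.root)
    (h22 : (2 : ℤ) • P.root i + (2 : ℤ) • P.root j ∉ Set.range P.root)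
    (h31 : (3 : ℤ) • P.root i + (1 : ℤ) • P.root j ∉ Set.range P.root)
    (h32 : (3 : ℤ) • P.root i + (2 : ℤ) • P.root j ∉ Set.range P.root) :
    ∃ m m' : ℤ, m.natAbs = P.chainBotCoeff i j + 1 ∧ ∀ s t : S,
      C.rootGL i (2 * s) * C.rootGL j t * (C.rootGL i (2 * s))⁻¹ =
        C.rootGL j t * C.rootGL k (2 * (m : S) * s * t) * C.rootGL l ((m' : S) * s ^ 2 * t) := by
  obtain ⟨m, hm, hb⟩ := C.exists_rep_commutator hk
  obtain ⟨m', -, hb'⟩ := C.exists_rep_commutator hl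
  -- Conjugating by `2 s` instead of `s` clears the denominator: `(2 s)² / 2 = 2 s²`. The relation
  -- is thus integral without any divisibility of the structure constants.
  refine ⟨m, 2 * (m * m'), hm, fun s t => ?_⟩
  have hi : P.root i = (1 : ℤ) • P.root i + (0 : ℤ) • P.root j := by module
  have hj : P.root j = (0 : ℤ) • P.root i + (1 : ℤ) • P.root j := by module
  have hk' : P.root k = (1 : ℤ) • P.root i + (1 : ℤ) • P.root j := by rw [hk]; module
  have hl' : P.root l = (2 : ℤ) • P.root i + (1 : ℤ) • P.root j := by rw [hl, hk]; module
  have cil := C.commute_rep_of_eq hli hi hl' (by decide) h31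
  have cjk := C.commute_rep_of_eq hli hj hk' (by decide) h12
  have cjl := C.commute_rep_of_eq hli hj hl' (by decide) h22
  have ckl := C.commute_rep_of_eq hli hk' hl' (by decide) h32
  have key := generalLinear_map_eq_of_complex
    (C.rootGL i (2 * X 0) * C.rootGL j (X 1) * (C.rootGL i (2 * X 0))⁻¹)
    (C.rootGL j (X 1) * C.rootGL k (2 * (m : MvPolynomial (Fin 2) ℤ) * X 0 * X 1) *
      C.rootGL l (((2 * (m * m') : ℤ) : MvPolynomial (Fin 2) ℤ) * X 0 ^ 2 * X 1)) ?_ s t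
  · simp only [map_mul, map_inv, C.rootGL_map, map_intCast, map_pow, map_ofNat, intEval_X,
      Matrix.cons_val_zero, Matrix.cons_val_one, Matrix.cons_val_fin_one] at key
    exact key
  · intro s t
    simp only [map_mul, C.rootGL_map, map_intCast, map_pow, map_ofNat, C.rootGL_inv, map_neg, intEval_X]
    apply Units.ext
    simp only [Units.val_mul, rootGL, C.rootMatrix_eq_exp, Matrix.cons_val_zero, neg_smul,
      Matrix.cons_val_one, Matrix.cons_val_fin_one]
    have := matrix_exp_conj_eq_of_chain (y₂ := (m * m' : ℂ) • C.rep (B.vec l)) (y₃ := 0) (z := 0)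
      (q := 0) (r := 0) hb
      (by rw [mul_smul_comm, smul_mul_assoc, ← smul_sub, hb', smul_smul])
      (sub_eq_zero.2 (cil.smul_right _).eq) (by simp) (cjk.smul_right _)
      (cjl.smul_right _) (.zero_right _) (.zero_right _) (by simp)
      (by rw [((ckl.smul_left _).smul_right _).eq]; simp) (.zero_right _)
      (.zero_right _) (.zero_right _) (.zero_right _) (2 * s) t
    rw [this]
    simp only [smul_zero, neg_zero, NormedSpace.exp_zero, mul_one, smul_smul]
    rw [show 2 * s * t * m = 2 * m * s * t by ring,
      show (2 * s) ^ 2 * t / 2 * (m * m') = ((2 * (m * m') : ℤ) : ℂ) * s ^ 2 * t by push_cast; ring]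

/-- The conjugation relation for roots `i, j` that form a base of a root system of type `G₂`, where
`i` is short. -/
theorem rootGL_conj_of_triple {i j k l m o : ι} (hk : P.root k = P.root i + P.root j)
    (hl : P.root l = P.root i + P.root k) (hm : P.root m = P.root i + P.root l)
    (ho : P.root o = P.root j + P.root m)
    (hli : LinearIndependent ℝ ![P.root i, P.root j])
    (hnot : ∀ a b : ℤ, (a, b) ∈ [((4, 1) : ℤ × ℤ), (1, 2), (2, 2), (4, 2), (5, 2), (3, 3), (4, 3),
      (5, 3), (6, 3)] → a • P.root i + b • P.root j ∉ Set.range P.root) :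
    ∃ c₁ c₂ c₃ c₄ : ℤ, c₁.natAbs = P.chainBotCoeff i j + 1 ∧ ∀ s t : S,
      C.rootGL i (6 * s) * C.rootGL j (2 * t) * (C.rootGL i (6 * s))⁻¹ =
        C.rootGL j (2 * t) * C.rootGL k (12 * (c₁ : S) * s * t) *
          C.rootGL l ((c₂ : S) * s ^ 2 * t) * C.rootGL m ((c₃ : S) * s ^ 3 * t) *
          C.rootGL o ((c₄ : S) * s ^ 3 * t ^ 2) := by
  have ho2 : P.root o = P.root k + P.root l := by rw [ho, hm, hl, hk]; abel
  obtain ⟨a, ha, hb⟩ := C.exists_rep_commutator hk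
  obtain ⟨a', -, hb'⟩ := C.exists_rep_commutator hl
  obtain ⟨a'', -, hb''⟩ := C.exists_rep_commutator hm
  obtain ⟨b, -, hbo⟩ := C.exists_rep_commutator ho
  obtain ⟨b', -, hbo'⟩ := C.exists_rep_commutator ho2
  -- These are the coefficients of the chain formula at `6 s` and `2 t`: `6² · 2 / 2 = 36`, `6³ · 2
  -- / 6 = 72`, and `6³ · 2² = 864` divided by `12` and by `4` for the last factor. The last one has
  -- two sources, since `o` is both `j + m` and `k + l`.
  refine ⟨a, 36 * (a * a'), 72 * (a * a' * a''),
    -(72 * (a * a' * a'' * b) + 216 * (a * (a * a') * b')), ha, fun s t => ?_⟩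
  have hi : P.root i = (1 : ℤ) • P.root i + (0 : ℤ) • P.root j := by module
  have hj : P.root j = (0 : ℤ) • P.root i + (1 : ℤ) • P.root j := by module
  have hk' : P.root k = (1 : ℤ) • P.root i + (1 : ℤ) • P.root j := by rw [hk]; module
  have hl' : P.root l = (2 : ℤ) • P.root i + (1 : ℤ) • P.root j := by rw [hl, hk]; module
  have hm' : P.root m = (3 : ℤ) • P.root i + (1 : ℤ) • P.root j := by rw [hm, hl, hk]; module
  have ho' : P.root o = (3 : ℤ) • P.root i + (2 : ℤ) • P.root j := by
    rw [ho, hm, hl, hk]; module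
  -- The nine pairs excluded by `hnot` are the sums of the nine pairs of roots whose root vectors
  -- must commute here.
  have cim := C.commute_rep_of_eq hli hi hm' (by decide) (hnot _ _ (by decide))
  have cjk := C.commute_rep_of_eq hli hj hk' (by decide) (hnot _ _ (by decide))
  have cjl := C.commute_rep_of_eq hli hj hl' (by decide) (hnot _ _ (by decide))
  have ckm := C.commute_rep_of_eq hli hk' hm' (by decide) (hnot _ _ (by decide))
  have clm := C.commute_rep_of_eq hli hl' hm' (by decide) (hnot _ _ (by decide))
  have cjo := C.commute_rep_of_eq hli hj ho' (by decide) (hnot _ _ (by decide))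
  have cko := C.commute_rep_of_eq hli hk' ho' (by decide) (hnot _ _ (by decide))
  have clo := C.commute_rep_of_eq hli hl' ho' (by decide) (hnot _ _ (by decide))
  have cmo := C.commute_rep_of_eq hli hm' ho' (by decide) (hnot _ _ (by decide))
  have key := generalLinear_map_eq_of_complex
    (C.rootGL i (6 * X 0) * C.rootGL j (2 * X 1) * (C.rootGL i (6 * X 0))⁻¹)
    (C.rootGL j (2 * X 1) * C.rootGL k (12 * (a : MvPolynomial (Fin 2) ℤ) * X 0 * X 1) *
      C.rootGL l (((36 * (a * a') : ℤ) : MvPolynomial (Fin 2) ℤ) * X 0 ^ 2 * X 1) *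
      C.rootGL m (((72 * (a * a' * a'') : ℤ) : MvPolynomial (Fin 2) ℤ) * X 0 ^ 3 * X 1) *
      C.rootGL o (((-(72 * (a * a' * a'' * b) + 216 * (a * (a * a') * b')) : ℤ) :
        MvPolynomial (Fin 2) ℤ) * X 0 ^ 3 * X 1 ^ 2)) ?_ s t
  · simp only [map_mul, map_inv, C.rootGL_map, map_intCast, map_pow, map_ofNat, intEval_X,
      Matrix.cons_val_zero, Matrix.cons_val_one, Matrix.cons_val_fin_one] at key
    exact key
  · intro s t
    simp only [map_mul, C.rootGL_map, map_intCast, map_pow, map_ofNat, C.rootGL_inv, map_neg, intEval_X]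
    apply Units.ext
    simp only [Units.val_mul, rootGL, C.rootMatrix_eq_exp, Matrix.cons_val_zero, neg_smul,
      Matrix.cons_val_one, Matrix.cons_val_fin_one]
    have := matrix_exp_conj_eq_of_chain (y₂ := (a * a' : ℂ) • C.rep (B.vec l))
      (y₃ := (a * a' * a'' : ℂ) • C.rep (B.vec m)) (z := C.rep (B.vec o))
      (q := a * a' * a'' * b) (r := a * (a * a') * b') hb
      (by rw [mul_smul_comm, smul_mul_assoc, ← smul_sub, hb', smul_smul])
      (by rw [mul_smul_comm, smul_mul_assoc, ← smul_sub, hb'', smul_smul])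
      (sub_eq_zero.2 (cim.smul_right _).eq) (cjk.smul_right _)
      (cjl.smul_right _) ((ckm.smul_right _).smul_left _) ((clm.smul_right _).smul_left _)
      (by rw [mul_smul_comm, smul_mul_assoc, ← smul_sub, hbo, smul_smul])
      (by rw [smul_mul_smul_comm, smul_mul_smul_comm, mul_comm (a * a' : ℂ), ← smul_sub, hbo',
        smul_smul])
      cjo (cko.smul_left _) (clo.smul_left _) (cmo.smul_left _) (6 * s) (2 * t)
    rw [this]
    simp only [smul_smul, ← neg_smul]
    rw [show 6 * s * (2 * t) * a = 12 * a * s * t by ring,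
      show (6 * s) ^ 2 * (2 * t) / 2 * (a * a') = ((36 * (a * a') : ℤ) : ℂ) * s ^ 2 * t by
        push_cast; ring,
      show (6 * s) ^ 3 * (2 * t) / 6 * (a * a' * a'') =
        ((72 * (a * a' * a'') : ℤ) : ℂ) * s ^ 3 * t by push_cast; ring,
      show -((6 * s) ^ 3 * (2 * t) ^ 2 * (a * a' * a'' * b / 12 + a * (a * a') * b' / 4)) =
        ((-(72 * (a * a' * a'' * b) + 216 * (a * (a * a') * b')) : ℤ) : ℂ) * s ^ 3 * t ^ 2 by
        push_cast; ring]

end Relations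

end UniversalLattice

end RootVectors

/-! ### Connectedness of irreducible root systems -/

section RootSystem

variable {ι V W : Type*} [Finite ι] [AddCommGroup V] [Module ℝ V] [AddCommGroup W] [Module ℝ W]
  {P : RootPairing ι ℝ V W} [P.IsCrystallographic] [P.IsReduced]

omit [Finite ι] [P.IsCrystallographic] in
lemma linearIndependent_of_root_eq_add {i j k : ι} (h : P.root k = P.root i + P.root j) :
    LinearIndependent ℝ ![P.root i, P.root j] :=
  P.linearIndependent_of_add_mem_range_root' ⟨k, h⟩

omit [P.IsReduced] in
/-- A function on an irreducible root system of rank at least two is constant if it takes the same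
value at `α`, `β` and `α + β` for any two roots `α`, `β` whose sum is a root. -/
theorem eq_of_forall_root_add [P.IsRootSystem] [P.IsIrreducible] (hrank : 2 ≤ Module.finrank ℝ V)
    {Y : Type*} {f : ι → Y}
    (hf : ∀ i j k, P.root k = P.root i + P.root j → f i = f k ∧ f j = f k) (i j : ι) :
    f i = f j := by
  -- For non-orthogonal, non-proportional roots either the sum or the difference is a root.
  have hnon : ∀ i j, P.pairingIn ℤ i j ≠ 0 → i ≠ j → P.root i ≠ -P.root j → f i = f j := by
    intro i j h h1 h2
    rcases lt_or_gt_of_ne h with h | h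
    · obtain ⟨k, hk⟩ := P.root_add_root_mem_of_pairingIn_neg h h2
      obtain ⟨e1, e2⟩ := hf i j k hk
      exact e1.trans e2.symm
    · obtain ⟨k, hk⟩ := P.root_sub_root_mem_of_pairingIn_pos h h1
      exact (hf k j i (by rw [hk]; abel)).2.symm
  have horth : ∀ i j, ¬ P.IsOrthogonal i j → P.pairingIn ℤ i j ≠ 0 := by
    intro i j h h0
    refine h ?_
    have h1 : P.pairing i j = 0 := by rw [← P.algebraMap_pairingIn ℤ, h0, map_zero]
    exact ⟨h1, P.pairing_eq_zero_iff.1 h1⟩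
  -- A root and its negative are compared through a third root, neither proportional nor orthogonal
  -- to them. It exists because the rank is at least two.
  have hneg : ∀ i, f (P.reflectionPerm i i) = f i := by
    intro i
    have htop : ¬ ∀ j, P.root j ∉ Submodule.span ℝ (P.root '' {i}) → ∀ k ∈ ({i} : Set ι),
        P.IsOrthogonal j k := by
      intro h
      have h1 := P.span_root_image_eq_top_of_forall_orthogonal {i} ⟨i, rfl⟩ h
      rw [Set.image_singleton] at h1
      have h2 := (finrank_span_singleton (K := ℝ) (P.ne_zero i)).le
      rw [h1, finrank_top] at h2
      omega
    push Not at htop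
    obtain ⟨j, hj, k, rfl, hjk⟩ := htop
    have hp := horth _ _ hjk
    have hs : P.root k ∈ Submodule.span ℝ (P.root '' {k}) :=
      Submodule.subset_span ⟨k, rfl, rfl⟩
    have n1 : j ≠ k := by rintro rfl; exact hj hs
    have n2 : P.root j ≠ -P.root k := fun h => hj (h ▸ neg_mem hs)
    have e1 := hnon j k hp n1 n2
    have e2 := hnon j (P.reflectionPerm k k) (by simpa using hp)
      (by rintro rfl; exact n2 (by simp))
      (by
        rw [P.root_reflectionPerm, P.reflection_apply_self, neg_neg]
        exact fun h => n1 (P.root.injective h))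
    exact e2.symm.trans e1
  have hclass : ∀ j k, f k = f i → ¬ P.IsOrthogonal j k → f j = f i := by
    intro j k hk hjk
    by_cases n1 : j = k
    · exact n1 ▸ hk
    by_cases n2 : P.root j = -P.root k
    · have : j = P.reflectionPerm k k := P.root.injective (by simp [n2])
      rw [this, hneg, hk]
    · exact (hnon j k (horth _ _ hjk) n1 n2).trans hk
  -- The class of `i` is closed under non-orthogonality, so it spans `V` by irreducibility. A root
  -- `j` outside the class would be orthogonal to all of `V`, yet its coroot takes the value `2` on
  -- it.
  by_contra hne
  have htop := P.span_root_image_eq_top_of_forall_orthogonal {k | f k = f i} ⟨i, rfl⟩ (by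
    intro j hj k hk
    by_contra hjk
    exact hj (Submodule.subset_span ⟨j, hclass j k hk hjk, rfl⟩))
  have hle : Submodule.span ℝ (P.root '' {k | f k = f i}) ≤ LinearMap.ker (P.coroot' j) := by
    rw [Submodule.span_le]
    rintro _ ⟨k, hk, rfl⟩
    have : P.IsOrthogonal j k := by
      by_contra hjk
      exact hne (hclass j k hk hjk).symm
    simpa [P.root_coroot'_eq_pairing] using this.2
  have h2 : P.root j ∈ LinearMap.ker (P.coroot' j) := hle (htop ▸ Submodule.mem_top)
  simp at h2

lemma chainTopCoeff_pos {i j k : ι} (h : P.root k = P.root i + P.root j) :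
    1 ≤ P.chainTopCoeff i j :=
  P.one_le_chainTopCoeff_of_root_add_mem ⟨k, h⟩

omit [P.IsReduced] in
lemma mem_range_iff_chain {i j : ι} (hli : LinearIndependent ℝ ![P.root i, P.root j]) (z : ℤ) :
    z • P.root i + (1 : ℤ) • P.root j ∈ Set.range P.root ↔
      -(P.chainBotCoeff i j : ℤ) ≤ z ∧ z ≤ P.chainTopCoeff i j := by
  rw [one_smul, add_comm, P.root_add_zsmul_mem_range_iff hli, Set.mem_Icc]

/-- If some root string has length three, the root system contains one of type `B₂`. -/
lemma containsB2_of_chain {i j : ι}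
    (hli : LinearIndependent ℝ ![P.root i, P.root j])
    (h : P.chainBotCoeff i j + P.chainTopCoeff i j = 2) : ContainsB2 P := by
  have h1 := P.chainBotCoeff_add_chainTopCoeff_eq_pairingIn_chainTopIdx hli
  have h2 : P.pairingIn ℤ (P.chainTopIdx i j) i = 2 := by rw [← h1]; exact_mod_cast h
  have hroot := P.root_chainTopIdx (i := i) (j := j)
  have h3 := P.pairingIn_pairingIn_mem_set_of_isCrystal_of_isRed' (P.chainTopIdx i j) i (by
      intro h4
      rw [hroot] at h4
      refine UniversalLattice.zsmul_add_zsmul_ne_zero hli (a := (P.chainTopCoeff i j : ℤ) - 1) (b := 1)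
        (by simp) ?_
      rw [sub_smul, natCast_zsmul, one_smul, one_smul]
      rw [← sub_eq_zero] at h4
      rw [← h4]
      abel) (by
      intro h4
      rw [hroot] at h4
      refine UniversalLattice.zsmul_add_zsmul_ne_zero hli (a := (P.chainTopCoeff i j : ℤ) + 1) (b := 1)
        (by simp) ?_
      rw [add_smul, natCast_zsmul, one_smul, one_smul]
      rw [← sub_eq_zero] at h4
      rw [← h4]
      abel)
  rw [h2] at h3
  have h5 : P.pairingIn ℤ i (P.chainTopIdx i j) = 1 := by
    simp only [Set.mem_insert_iff, Prod.mk.injEq, Set.mem_singleton_iff] at h3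
    omega
  -- The root at the top of the string and `i` have Cartan integers `2` and `1`. Negating the former
  -- gives the signs of a base.
  exact ⟨P.reflectionPerm (P.chainTopIdx i j) (P.chainTopIdx i j), i, by simp [h2], by simp [h5]⟩

end RootSystem

/-! ### Multiplications from commutator relations -/

section ElementaryGroup

variable {ι V W : Type*} [Finite ι] [AddCommGroup V] [Module ℝ V] [AddCommGroup W] [Module ℝ W]
  {P : RootPairing ι ℝ V W} [P.IsCrystallographic]
  {L : Type*} [LieRing L] [LieAlgebra ℂ L] [FiniteDimensional ℂ L] [LieAlgebra.IsKilling ℂ L]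
  {H : LieSubalgebra ℂ L} [H.IsCartanSubalgebra]

lemma isUnit_intCast_of_natAbs {R : Type*} [CommRing R] {m : ℤ} {k : ℕ} (hm : m.natAbs = k)
    (hk : IsUnit (k : R)) : IsUnit (m : R) := by
  rcases Int.natAbs_eq m with h | h <;> rw [h, hm]
  · simpa using hk
  · simpa using hk

lemma mul_mul_inv_mul_cancel_right {Γ : Type*} [Group Γ] (a b c : Γ) :
    a * b * (c * b)⁻¹ = a * c⁻¹ := by
  group

/-- For fixed `s`, the element `yi (6 * s)` is a constant matrix, so nothing about the algebra of
`yi` is needed. The factors `yj`, `ym`, `yo` have coordinates in `S` as functions of `t`, which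
leaves only the product of `yk` and `yl`. -/
lemma coordAlg_le_of_relation {R K : Type*} [CommRing R] [Field K] {n : ℕ}
    {yi yj yk yl ym yo : R → GL (Fin n) K} (hadd : ∀ s t, yk (s + t) = yk s * yk t)
    (hneg : ∀ t, yk (-t) = (yk t)⁻¹) {c₁ c₂ c₃ c₄ v : R}
    (hrel : ∀ s t, yi (6 * s) * yj (2 * t) * (yi (6 * s))⁻¹ =
      yj (2 * t) * yk (12 * c₁ * s * t) * yl (c₂ * s ^ 2 * t) * ym (c₃ * s ^ 3 * t) *
        yo (c₄ * s ^ 3 * t ^ 2)) (hv : 24 * c₁ * v = 1) {S : Subalgebra K (R → K)}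
    (hj : ∀ u, (fun t => yj (u * t)) ∈ coordSubgroup n S)
    (hm : ∀ u, (fun t => ym (u * t)) ∈ coordSubgroup n S)
    (ho : ∀ u, (fun t => yo (u * t ^ 2)) ∈ coordSubgroup n S) : coordAlg yk ≤ S := by
  have hw : ∀ s t, yk (12 * c₁ * s * t) * yl (c₂ * s ^ 2 * t) = (yj (2 * t))⁻¹ *
      (yi (6 * s) * yj (2 * t) * (yi (6 * s))⁻¹) * (yo (c₄ * s ^ 3 * t ^ 2))⁻¹ *
      (ym (c₃ * s ^ 3 * t))⁻¹ := by
    intro s t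
    rw [hrel]
    group
  have hwS : ∀ s, (fun t => yk (12 * c₁ * s * (v * t)) * yl (c₂ * s ^ 2 * (v * t))) ∈
      coordSubgroup n S := by
    intro s
    have e1 : (fun t => yj (2 * (v * t))) ∈ coordSubgroup n S := by
      simpa only [mul_assoc] using hj (2 * v)
    have e2 : (fun t => ym (c₃ * s ^ 3 * (v * t))) ∈ coordSubgroup n S := by
      convert hm (c₃ * s ^ 3 * v) using 3
      ring
    have e3 : (fun t => yo (c₄ * s ^ 3 * (v * t) ^ 2)) ∈ coordSubgroup n S := by
      convert ho (c₄ * s ^ 3 * v ^ 2) using 3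
      ring
    have e4 := const_mem_coordSubgroup S (yi (6 * s))
    simp only [hw]
    exact mul_mem (mul_mem (mul_mem (inv_mem e1) (mul_mem (mul_mem e4 e1) (inv_mem e4)))
      (inv_mem e3)) (inv_mem e2)
  rw [coordAlg_le_iff]
  -- The factor `yl` is even in `s`, so it cancels between `s = 1` and `s = -1`. The two arguments
  -- of `yk` add up to `24 * c₁ * v * t = t`.
  have hk : yk = (fun t => yk (12 * c₁ * 1 * (v * t)) * yl (c₂ * 1 ^ 2 * (v * t))) *
      (fun t => yk (12 * c₁ * (-1) * (v * t)) * yl (c₂ * (-1) ^ 2 * (v * t)))⁻¹ := by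
    funext t
    rw [Pi.mul_apply, Pi.inv_apply, neg_sq, mul_mul_inv_mul_cancel_right, ← hneg, ← hadd]
    congr 1
    linear_combination -t * hv
  rw [hk]
  exact mul_mem (hwS 1) (inv_mem (hwS (-1)))

/-! ### Images of root subgroups under a representation -/

namespace UniversalLattice

variable {B : ChevalleyBasis P H} {N : ℕ} (G : UniversalLattice B N)
  {R : Type*} [CommRing R] {K : Type*} [Field K] {n : ℕ} (ρ : G.elementary R →* GL (Fin n) K)

/-- The inclusion of the elementary group in `GL_N(R)`. -/
def elementaryToGL : G.elementary R →* GL (Fin N) R :=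
  (G.points R).subtype.comp (G.elementary R).subtype

/-- Matrix relations in `GL_N(R)` thereby hold in the elementary group, where `ρ` can be applied to
them. -/
lemma elementaryToGL_injective : Function.Injective (G.elementaryToGL (R := R)) :=
  (Subtype.val_injective).comp Subtype.val_injective

lemma elementaryToGL_elem (i : ι) (t : R) : G.elementaryToGL (G.elem i t) = G.rootGL i t := rfl

/-- The image under the representation of the root subgroup of `i`. -/
def oneParam (i : ι) (t : R) : GL (Fin n) K := ρ (G.elem i t)

lemma oneParam_add (i : ι) (s t : R) :
    G.oneParam ρ i (s + t) = G.oneParam ρ i s * G.oneParam ρ i t := by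
  rw [oneParam, oneParam, oneParam, ← map_mul]
  congr 1
  apply G.elementaryToGL_injective
  rw [map_mul]
  simp only [elementaryToGL_elem]
  exact Units.ext (G.rootMatrix_add i s t)

lemma oneParam_neg (i : ι) (t : R) : G.oneParam ρ i (-t) = (G.oneParam ρ i t)⁻¹ := by
  rw [oneParam, oneParam, ← map_inv]
  congr 1
  apply G.elementaryToGL_injective
  rw [map_inv]
  simp only [elementaryToGL_elem, rootGL_inv]

lemma oneParam_two_mul (i : ι) (t : R) :
    G.oneParam ρ i (2 * t) = G.oneParam ρ i t * G.oneParam ρ i t := by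
  rw [two_mul, oneParam_add]

variable [P.IsRootSystem]

/-- The commutator relation writes `x_k(m s t)` as a group word in `x_i(s)` and `x_j(t)`, and the
coordinates of a word are polynomials in those of its letters. -/
theorem hasMul_of_simple {i j k : ι} (hk : P.root k = P.root i + P.root j)
    (hli : LinearIndependent ℝ ![P.root i, P.root j])
    (h21 : (2 : ℤ) • P.root i + (1 : ℤ) • P.root j ∉ Set.range P.root)
    (h12 : (1 : ℤ) • P.root i + (2 : ℤ) • P.root j ∉ Set.range P.root)
    (hu : IsUnit ((P.chainBotCoeff i j + 1 : ℕ) : R)) : HasMul (G.oneParam ρ) i j k := by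
  obtain ⟨m, hm, hrel⟩ := G.rootGL_conj_of_simple (S := R) hk hli h21 h12
  refine ⟨m, isUnit_intCast_of_natAbs hm hu, ?_⟩
  have hrel' : ∀ s t : R, G.oneParam ρ k (m * s * t) = (G.oneParam ρ j t)⁻¹ *
      (G.oneParam ρ i s * G.oneParam ρ j t * (G.oneParam ρ i s)⁻¹) := by
    intro s t
    simp only [oneParam, ← map_mul, ← map_inv]
    congr 1
    apply G.elementaryToGL_injective
    simp only [map_mul, map_inv, elementaryToGL_elem]
    rw [hrel, inv_mul_cancel_left]
  simp only [hrel']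
  have hi := comp_fst_mem_coordSubgroup (coordAlg (G.oneParam ρ j))
    (mem_coordSubgroup_coordAlg (G.oneParam ρ i))
  have hj := comp_snd_mem_coordSubgroup (coordAlg (G.oneParam ρ i))
    (mem_coordSubgroup_coordAlg (G.oneParam ρ j))
  exact mul_mem (inv_mem hj) (mul_mem (mul_mem hi hj) (inv_mem hi))

/-- The word `w s t` equals `x_k(2 m s t) x_l(m' s² t)`. The second factor is even in `s`, so `w s t
* (w (-s) t)⁻¹` is `x_k(4 m s t)`, and `4 m` is a unit. -/
theorem hasMul_of_double {i j k l : ι} (hk : P.root k = P.root i + P.root j)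
    (hl : P.root l = P.root i + P.root k)
    (hli : LinearIndependent ℝ ![P.root i, P.root j])
    (h12 : (1 : ℤ) • P.root i + (2 : ℤ) • P.root j ∉ Set.range P.root)
    (h22 : (2 : ℤ) • P.root i + (2 : ℤ) • P.root j ∉ Set.range P.root)
    (h31 : (3 : ℤ) • P.root i + (1 : ℤ) • P.root j ∉ Set.range P.root)
    (h32 : (3 : ℤ) • P.root i + (2 : ℤ) • P.root j ∉ Set.range P.root)
    (hu : IsUnit ((P.chainBotCoeff i j + 1 : ℕ) : R)) (h2 : IsUnit (2 : R)) :
    HasMul (G.oneParam ρ) i j k := by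
  obtain ⟨m, m', hm, hrel⟩ := G.rootGL_conj_of_double (S := R) hk hl hli h12 h22 h31 h32
  refine ⟨2 * (2 * m), h2.mul (h2.mul (isUnit_intCast_of_natAbs hm hu)), ?_⟩
  let w : R → R → GL (Fin n) K := fun s t => (G.oneParam ρ j t)⁻¹ *
    (G.oneParam ρ i (2 * s) * G.oneParam ρ j t * (G.oneParam ρ i (2 * s))⁻¹)
  have hw : ∀ s t, w s t =
      G.oneParam ρ k (2 * (m : R) * s * t) * G.oneParam ρ l ((m' : R) * s ^ 2 * t) := by
    intro s t
    simp only [w, oneParam, ← map_mul, ← map_inv]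
    congr 1
    apply G.elementaryToGL_injective
    simp only [map_mul, map_inv, elementaryToGL_elem]
    rw [hrel, mul_assoc, inv_mul_cancel_left]
  have hrel' : ∀ s t : R, G.oneParam ρ k (2 * (2 * m) * s * t) = w s t * (w (-s) t)⁻¹ := by
    intro s t
    rw [hw, hw, neg_sq, mul_mul_inv_mul_cancel_right, ← oneParam_neg, ← oneParam_add]
    congr 1
    ring
  simp only [hrel', w, oneParam_neg, oneParam_two_mul]
  have hi := comp_fst_mem_coordSubgroup (coordAlg (G.oneParam ρ j))
    (mem_coordSubgroup_coordAlg (G.oneParam ρ i))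
  have hj := comp_snd_mem_coordSubgroup (coordAlg (G.oneParam ρ i))
    (mem_coordSubgroup_coordAlg (G.oneParam ρ j))
  have hii := mul_mem hi hi
  exact mul_mem (mul_mem (inv_mem hj) (mul_mem (mul_mem hii hj) (inv_mem hii)))
    (inv_mem (mul_mem (inv_mem hj) (mul_mem (mul_mem (inv_mem hii) hj) (inv_mem (inv_mem hii)))))

/-- For roots `i` (short) and `j` (long) that form a base of a root system of type `G₂`, the
coordinates of the short root `i + j` are polynomials in those of the long roots. -/
theorem coordAlg_le_of_triple {i j k l m o : ι} (hk : P.root k = P.root i + P.root j)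
    (hl : P.root l = P.root i + P.root k) (hm : P.root m = P.root i + P.root l)
    (ho : P.root o = P.root j + P.root m)
    (hli : LinearIndependent ℝ ![P.root i, P.root j])
    (hnot : ∀ a b : ℤ, (a, b) ∈ [((4, 1) : ℤ × ℤ), (1, 2), (2, 2), (4, 2), (5, 2), (3, 3), (4, 3),
      (5, 3), (6, 3)] → a • P.root i + b • P.root j ∉ Set.range P.root)
    (hu : IsUnit ((P.chainBotCoeff i j + 1 : ℕ) : R)) (h2 : IsUnit (2 : R)) (h3 : IsUnit (3 : R))
    {S : Subalgebra K (R → K)}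
    (hj : ∀ u, (fun t => G.oneParam ρ j (u * t)) ∈ coordSubgroup n S)
    (hm' : ∀ u, (fun t => G.oneParam ρ m (u * t)) ∈ coordSubgroup n S)
    (ho' : ∀ u, (fun t => G.oneParam ρ o (u * t ^ 2)) ∈ coordSubgroup n S) :
    coordAlg (G.oneParam ρ k) ≤ S := by
  obtain ⟨c₁, c₂, c₃, c₄, hc, hrel⟩ := G.rootGL_conj_of_triple (S := R) hk hl hm ho hli hnot
  have hunit : IsUnit (24 * (c₁ : R)) := by
    have : 24 * (c₁ : R) = 2 * (2 * (2 * (3 * c₁))) := by ring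
    rw [this]
    exact h2.mul (h2.mul (h2.mul (h3.mul (isUnit_intCast_of_natAbs hc hu))))
  obtain ⟨v, hv⟩ := hunit.exists_right_inv
  refine coordAlg_le_of_relation (yi := G.oneParam ρ i) (yl := G.oneParam ρ l)
    (c₂ := (c₂ : R)) (c₃ := (c₃ : R)) (c₄ := (c₄ : R)) (G.oneParam_add ρ k) (G.oneParam_neg ρ k) (fun s t => ?_) hv hj hm' ho'
  simp only [oneParam, ← map_mul, ← map_inv]
  congr 1
  apply G.elementaryToGL_injective
  simp only [map_mul, map_inv, elementaryToGL_elem]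
  exact hrel s t

/-! ### Root systems not of type `G₂` -/

/-- For a nice pair not of type `G₂`, there is a multiplication for any two roots whose sum is a
root. -/
theorem hasMul_of_isNotG2 [P.IsReduced] (hG : P.IsNotG2)
    (hB : ContainsB2 P → IsUnit (2 : R)) {i j k : ι} (hk : P.root k = P.root i + P.root j) :
    HasMul (G.oneParam ρ) i j k ∨ HasMul (G.oneParam ρ) j i k := by
  have hle : ∀ a b, P.chainBotCoeff a b + P.chainTopCoeff a b ≤ 2 :=
    fun a b => P.chainBotCoeff_add_chainTopCoeff_le_two a b
  have hdouble : ∀ {i j k l : ι}, P.root k = P.root i + P.root j → P.root l = P.root i + P.root k →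
      HasMul (G.oneParam ρ) i j k := by
    intro i j k l hk hl
    have hli := linearIndependent_of_root_eq_add hk
    have hik := linearIndependent_of_root_eq_add hl
    have hki : LinearIndependent ℝ ![P.root k, P.root i] :=
      linearIndependent_of_root_eq_add (k := l) (by rw [hl, add_comm])
    have htop : 2 ≤ P.chainTopCoeff i j :=
      Nat.cast_le.1 ((mem_range_iff_chain hli 2).1 ⟨l, by rw [hl, hk]; module⟩).2
    have hsum : P.chainBotCoeff i j + P.chainTopCoeff i j = 2 := by have := hle i j; omega
    have hB2 := hB (containsB2_of_chain hli hsum)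
    have hbot : P.chainBotCoeff i j = 0 := by omega
    -- Both `i + k = l` and `i - k = -j` are roots, and strings have at most three members. So the
    -- `k`-string through `i` is exactly these with `i`, which excludes `i + 2k = 3i + 2j` and `i -
    -- 2k = -(i + 2j)`.
    have b1 := (mem_range_iff_chain hki 1).1 ⟨l, by rw [hl]; module⟩
    have b2 := (mem_range_iff_chain hki (-1)).1 ⟨P.reflectionPerm j j, by
      rw [P.root_reflectionPerm, P.reflection_apply_self, hk]; module⟩
    have b3 := hle k i
    refine G.hasMul_of_double ρ hk hl hli ?_ ?_ ?_ ?_ (by simp [hbot]) hB2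
    · rintro ⟨o, ho⟩
      have := (mem_range_iff_chain hki (-2)).1 ⟨P.reflectionPerm o o, by
        rw [P.root_reflectionPerm, P.reflection_apply_self, hk, ho]; module⟩
      omega
    · rintro ⟨o, ho⟩
      have : IsAddTorsionFree V := .of_isTorsionFree ℝ V
      refine P.nsmul_notMem_range_root (i := k) (n := 2) ⟨o, ?_⟩
      rw [ho, hk]
      module
    · intro h
      have := (mem_range_iff_chain hli 3).1 h
      omega
    · rintro ⟨o, ho⟩
      have := (mem_range_iff_chain hki 2).1 ⟨o, by rw [ho, hk]; module⟩
      omega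
  by_cases h21 : (2 : ℤ) • P.root i + (1 : ℤ) • P.root j ∈ Set.range P.root
  · obtain ⟨l, hl⟩ := h21
    exact Or.inl (hdouble hk (l := l) (by rw [hl, hk]; module))
  by_cases h12 : (1 : ℤ) • P.root i + (2 : ℤ) • P.root j ∈ Set.range P.root
  · obtain ⟨l, hl⟩ := h12
    exact Or.inr (hdouble (by rw [hk, add_comm]) (l := l) (by rw [hl, hk]; module))
  refine Or.inl (G.hasMul_of_simple ρ hk (linearIndependent_of_root_eq_add hk) h21 h12 ?_)
  have h1 := chainTopCoeff_pos hk
  have h2 := hle i j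
  -- The structure constant is `±1` or `±2`. In the second case the string has three members, so
  -- there is a subsystem of type `B₂` and `2` is a unit.
  have h3 : P.chainBotCoeff i j = 0 ∨ P.chainBotCoeff i j = 1 := by omega
  rcases h3 with h3 | h3
  · simp [h3]
  · have := hB (containsB2_of_chain (linearIndependent_of_root_eq_add hk) (by omega))
    rw [h3]
    exact_mod_cast this

/-- A multiplication gives the inclusion of the algebra of `i + j` in that of `i`. The reverse
inclusion is the same statement for `i = (i + j) + (-j)`. -/
theorem coordAlg_eq_of_isNotG2 [P.IsReduced] [P.IsIrreducible] (hrank : 2 ≤ Module.finrank ℝ V)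
    (hG : P.IsNotG2) (hB : ContainsB2 P → IsUnit (2 : R)) (i j : ι) :
    coordAlg (G.oneParam ρ i) = coordAlg (G.oneParam ρ j) := by
  have hle : ∀ {i j k}, P.root k = P.root i + P.root j →
      coordAlg (G.oneParam ρ k) ≤ coordAlg (G.oneParam ρ i) ∧
      coordAlg (G.oneParam ρ k) ≤ coordAlg (G.oneParam ρ j) := by
    intro i j k hk
    rcases G.hasMul_of_isNotG2 ρ hG hB hk with h | h
    · exact ⟨h.le_left, h.le_right⟩
    · exact ⟨h.le_right, h.le_left⟩
  refine eq_of_forall_root_add (P := P) hrank (f := fun i => coordAlg (G.oneParam ρ i))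
    (fun i j k hk => ⟨?_, ?_⟩) i j
  · refine le_antisymm (hle (i := k) (j := P.reflectionPerm j j) ?_).1 (hle hk).1
    rw [P.root_reflectionPerm, P.reflection_apply_self, hk]
    abel
  · refine le_antisymm (hle (i := k) (j := P.reflectionPerm i i) ?_).1 (hle hk).2
    rw [P.root_reflectionPerm, P.reflection_apply_self, hk]
    abel

end UniversalLattice

end ElementaryGroup

/-! ### Root systems of type `G₂` -/

section TypeG2

variable {ι V W : Type*} [Finite ι] [AddCommGroup V] [Module ℝ V] [AddCommGroup W] [Module ℝ W]
  {P : RootPairing ι ℝ V W} [P.IsCrystallographic] [P.IsReduced] [P.IsIrreducible]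

/-- The coordinates of the long roots of `G₂` with respect to a base. -/
abbrev longCoeffs : List (ℤ × ℤ) := [(0, 1), (3, 2), (3, 1), (0, -1), (-3, -2), (-3, -1)]

/-- The coordinates of the short roots of `G₂` with respect to a base. -/
abbrev shortCoeffs : List (ℤ × ℤ) := [(1, 0), (1, 1), (2, 1), (-1, 0), (-1, -1), (-2, -1)]

-- Labelling the roots by their coordinates in a base reduces all questions about which combinations
-- are roots to finite lists in `ℤ × ℤ`, settled by `decide`.
omit [P.IsCrystallographic] [P.IsReduced] in
lemma exists_labelling_of_isG2 (hG : P.IsG2) : ∃ (α β : V) (r : ℤ × ℤ → ι),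
    (∀ v ∈ longCoeffs ++ shortCoeffs, P.root (r v) = v.1 • α + v.2 • β) ∧
    (∀ i, ∃ v ∈ longCoeffs ++ shortCoeffs, r v = i) ∧
    ∀ v : ℤ × ℤ, v.1 • α + v.2 • β ∈ Set.range P.root → v ∈ longCoeffs ++ shortCoeffs := by
  classical
  let _ := RootPairing.IsG2.toEmbeddedG2 P
  set α := P.root (RootPairing.EmbeddedG2.short P) with hα
  set β := P.root (RootPairing.EmbeddedG2.long P) with hβ
  have hmem : ∀ i, ∃ v ∈ longCoeffs ++ shortCoeffs, P.root i = v.1 • α + v.2 • β := by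
    intro i
    have h := RootPairing.EmbeddedG2.mem_allRoots P i
    rw [RootPairing.EmbeddedG2.allRoots_eq_map_allCoeffs, List.mem_map] at h
    obtain ⟨c, hc, h⟩ := h
    refine ⟨(c 0, c 1), ?_, ?_⟩
    · clear h
      revert c
      decide
    · rw [← h, Fintype.linearCombination_apply, Fin.sum_univ_two]
      rfl
  have hrange : ∀ v ∈ longCoeffs ++ shortCoeffs, v.1 • α + v.2 • β ∈ Set.range P.root := by
    intro v hv
    refine RootPairing.EmbeddedG2.allRoots_subset_range_root P ?_
    rw [Finset.mem_coe, List.mem_toFinset, RootPairing.EmbeddedG2.allRoots_eq_map_allCoeffs,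
      List.mem_map]
    refine ⟨![v.1, v.2], ?_, ?_⟩
    · revert v
      decide
    · rw [Fintype.linearCombination_apply, Fin.sum_univ_two]
      rfl
  have hinj : ∀ v w : ℤ × ℤ, v.1 • α + v.2 • β = w.1 • α + w.2 • β → v = w := by
    intro v w h
    have hli := (RootPairing.EmbeddedG2.linearIndependent_short_long P).restrict_scalars' ℤ
    have := LinearIndependent.pair_iff.1 hli (v.1 - w.1) (v.2 - w.2) (by
      rw [← sub_eq_zero] at h
      rw [← h]
      module)
    exact Prod.ext (by omega) (by omega)
  have : Nonempty ι := RootPairing.IsG2.nonempty P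
  choose! r hr using hrange
  refine ⟨α, β, r, hr, fun i => ?_, ?_⟩
  · obtain ⟨v, hv, h⟩ := hmem i
    exact ⟨v, hv, P.root.injective ((hr v hv).trans h.symm)⟩
  · rintro v ⟨i, hi⟩
    obtain ⟨w, hw, h⟩ := hmem i
    rw [hinj v w (hi.symm.trans h)]
    exact hw

namespace UniversalLattice

variable [P.IsRootSystem]
  {L : Type*} [LieRing L] [LieAlgebra ℂ L] [FiniteDimensional ℂ L] [LieAlgebra.IsKilling ℂ L]
  {H : LieSubalgebra ℂ L} [H.IsCartanSubalgebra]
  {B : ChevalleyBasis P H} {N : ℕ} (G : UniversalLattice B N)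
  {R : Type*} [CommRing R] {K : Type*} [Field K] {n : ℕ} (ρ : G.elementary R →* GL (Fin n) K)

-- A root string has at most four members, and one of them lies above `j`, so the integer is `1`,
-- `2` or `3`.
omit [P.IsIrreducible] [P.IsRootSystem] in
lemma isUnit_chainBotCoeff_add_one {i j k : ι} (hk : P.root k = P.root i + P.root j)
    (h2 : IsUnit (2 : R)) (h3 : IsUnit (3 : R)) : IsUnit ((P.chainBotCoeff i j + 1 : ℕ) : R) := by
  have h := RootPairing.chainBotCoeff_add_chainTopCoeff_le_three (P := P) (i := i) (j := j)
  have ht := chainTopCoeff_pos hk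
  have hb : P.chainBotCoeff i j = 0 ∨ P.chainBotCoeff i j = 1 ∨ P.chainBotCoeff i j = 2 := by omega
  rcases hb with h | h | h <;> rw [h]
  · simp
  · exact_mod_cast h2
  · exact_mod_cast h3

/-- The long roots share one algebra and have a multiplication among themselves. It lies in the
algebra of each short root, because suitable short roots add up to long ones. For the converse, a
short root is written as short plus long, and the full conjugation relation of `G₂` is used. -/
theorem coordAlg_eq_of_isG2 (hG : P.IsG2) (h2 : IsUnit (2 : R)) (h3 : IsUnit (3 : R)) :
    (∀ i j, coordAlg (G.oneParam ρ i) = coordAlg (G.oneParam ρ j)) ∧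
      ∃ i j k, HasMul (G.oneParam ρ) i j k := by
  obtain ⟨α, β, r, hr, hsurj, hrange⟩ := exists_labelling_of_isG2 hG
  have hcomb : ∀ v ∈ longCoeffs ++ shortCoeffs, ∀ w ∈ longCoeffs ++ shortCoeffs, ∀ a b : ℤ,
      a • P.root (r v) + b • P.root (r w) = (a • v + b • w).1 • α + (a • v + b • w).2 • β := by
    intro v hv w hw a b
    rw [hr v hv, hr w hw]
    simp only [Prod.fst_add, Prod.snd_add, Prod.smul_fst, Prod.smul_snd, smul_eq_mul]
    module
  have hadd : ∀ v ∈ longCoeffs ++ shortCoeffs, ∀ w ∈ longCoeffs ++ shortCoeffs,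
      v + w ∈ longCoeffs ++ shortCoeffs → P.root (r (v + w)) = P.root (r v) + P.root (r w) := by
    intro v hv w hw hvw
    simpa only [one_smul, hr (v + w) hvw] using (hcomb v hv w hw 1 1).symm
  have hmul : ∀ v w u : ℤ × ℤ, v ∈ longCoeffs ++ shortCoeffs ∧ w ∈ longCoeffs ++ shortCoeffs ∧
      u ∈ longCoeffs ++ shortCoeffs ∧ v + w = u ∧
      (2 : ℤ) • v + (1 : ℤ) • w ∉ longCoeffs ++ shortCoeffs ∧
      (1 : ℤ) • v + (2 : ℤ) • w ∉ longCoeffs ++ shortCoeffs →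
      HasMul (G.oneParam ρ) (r v) (r w) (r u) := by
    rintro v w _ ⟨hv, hw, hvw, rfl, h21, h12⟩
    have hk := hadd v hv w hw hvw
    refine G.hasMul_of_simple ρ hk (linearIndependent_of_root_eq_add hk) ?_ ?_
      (isUnit_chainBotCoeff_add_one hk h2 h3)
    · rw [hcomb v hv w hw]
      exact fun h => h21 (hrange _ h)
    · rw [hcomb v hv w hw]
      exact fun h => h12 (hrange _ h)
  let A : ℤ × ℤ → Subalgebra K (R → K) := fun v => coordAlg (G.oneParam ρ (r v))
  -- Each long root is its neighbour in the hexagon plus another long root. Six inclusions around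
  -- the hexagon force equality.
  have l1 : A (0, 1) ≤ A (3, 2) :=
    (hmul (3, 2) (-3, -1) (0, 1) (by decide)).le_left
  have l2 : A (3, 2) ≤ A (3, 1) :=
    (hmul (3, 1) (0, 1) (3, 2) (by decide)).le_left
  have l3 : A (3, 1) ≤ A (0, -1) :=
    (hmul (0, -1) (3, 2) (3, 1) (by decide)).le_left
  have l4 : A (0, -1) ≤ A (-3, -2) :=
    (hmul (-3, -2) (3, 1) (0, -1) (by decide)).le_left
  have l5 : A (-3, -2) ≤ A (-3, -1) :=
    (hmul (-3, -1) (0, -1) (-3, -2) (by decide)).le_left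
  have l6 : A (-3, -1) ≤ A (0, 1) :=
    (hmul (0, 1) (-3, -2) (-3, -1) (by decide)).le_left
  have e2 : A (3, 2) = A (0, 1) :=
    le_antisymm (l2.trans (l3.trans (l4.trans (l5.trans l6)))) l1
  have e3 : A (3, 1) = A (0, 1) :=
    le_antisymm (l3.trans (l4.trans (l5.trans l6))) (l1.trans l2)
  have e4 : A (0, -1) = A (0, 1) :=
    le_antisymm (l4.trans (l5.trans l6)) (l1.trans (l2.trans l3))
  have e5 : A (-3, -2) = A (0, 1) :=
    le_antisymm (l5.trans l6) (l1.trans (l2.trans (l3.trans l4)))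
  have e6 : A (-3, -1) = A (0, 1) :=
    le_antisymm l6 (l1.trans (l2.trans (l3.trans (l4.trans l5))))
  have hlong : ∀ v ∈ longCoeffs, A v = A (0, 1) := by
    intro v hv
    simp only [longCoeffs, List.mem_cons, List.not_mem_nil, or_false] at hv
    rcases hv with rfl | rfl | rfl | rfl | rfl | rfl
    exacts [rfl, e2, e3, e4, e5, e6]
  have hlong_le : ∀ v ∈ shortCoeffs, A (0, 1) ≤ A v := by
    intro v hv
    simp only [shortCoeffs, List.mem_cons, List.not_mem_nil, or_false] at hv
    rcases hv with rfl | rfl | rfl | rfl | rfl | rfl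
    · exact e3.ge.trans
        (hmul (1, 0) (2, 1) (3, 1) (by decide)).le_left
    · exact e2.ge.trans
        (hmul (1, 1) (2, 1) (3, 2) (by decide)).le_left
    · exact e3.ge.trans
        (hmul (1, 0) (2, 1) (3, 1) (by decide)).le_right
    · exact e6.ge.trans
        (hmul (-1, 0) (-2, -1) (-3, -1) (by decide)).le_left
    · exact e5.ge.trans
        (hmul (-1, -1) (-2, -1) (-3, -2) (by decide)).le_left
    · exact e6.ge.trans
        (hmul (-1, 0) (-2, -1) (-3, -1) (by decide)).le_right
  have hlong_mul : ∀ v ∈ longCoeffs, ∃ i j, HasMul (G.oneParam ρ) i j (r v) ∧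
      coordAlg (G.oneParam ρ i) = A v ∧ coordAlg (G.oneParam ρ j) = A v := by
    have key : ∀ v ∈ longCoeffs, ∃ u ∈ longCoeffs, ∃ w ∈ longCoeffs, u + w = v ∧
        (2 : ℤ) • u + (1 : ℤ) • w ∉ longCoeffs ++ shortCoeffs ∧
        (1 : ℤ) • u + (2 : ℤ) • w ∉ longCoeffs ++ shortCoeffs := by
      decide
    intro v hv
    obtain ⟨u, hu, w, hw, rfl, h21, h12⟩ := key v hv
    refine ⟨r u, r w, hmul u w _ ⟨List.mem_append_left _ hu, List.mem_append_left _ hw,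
      List.mem_append_left _ hv, rfl, h21, h12⟩, ?_, ?_⟩
    · exact (hlong u hu).trans (hlong _ hv).symm
    · exact (hlong w hw).trans (hlong _ hv).symm
  have hsmul : ∀ v ∈ longCoeffs, ∀ a,
      (fun t => G.oneParam ρ (r v) (a * t)) ∈ coordSubgroup n (A (0, 1)) := by
    intro v hv
    obtain ⟨i, j, h, hi, hj⟩ := hlong_mul v hv
    rw [← hlong v hv]
    exact h.smul_mem hi hj
  have hsq : ∀ v ∈ longCoeffs, ∀ a,
      (fun t => G.oneParam ρ (r v) (a * t ^ 2)) ∈ coordSubgroup n (A (0, 1)) := by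
    intro v hv
    obtain ⟨i, j, h, hi, hj⟩ := hlong_mul v hv
    rw [← hlong v hv]
    exact h.sq_mem hi hj
  -- The short root `v` is `u + w`, where `u` (short) and `w` (long) form a base of `G₂`. Besides
  -- `v`, the right side of the conjugation relation involves the long roots `w`, `3u + w`, `3u +
  -- 2w`, already controlled, and the short root `2u + w`, which cancels.
  have hshort_le : ∀ v ∈ shortCoeffs, A v ≤ A (0, 1) := by
    have key : ∀ v ∈ shortCoeffs, ∃ u ∈ shortCoeffs, ∃ w ∈ longCoeffs, u + w = v ∧
        u + v ∈ shortCoeffs ∧ u + (u + v) ∈ longCoeffs ∧ w + (u + (u + v)) ∈ longCoeffs ∧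
        ∀ p ∈ [((4, 1) : ℤ × ℤ), (1, 2), (2, 2), (4, 2), (5, 2), (3, 3), (4, 3), (5, 3), (6, 3)],
          p.1 • u + p.2 • w ∉ longCoeffs ++ shortCoeffs := by
      decide
    intro v hv
    obtain ⟨u, hu, w, hw, rfl, hl, hm, ho, hnot⟩ := key v hv
    have hu' := List.mem_append_right longCoeffs hu
    have hw' := List.mem_append_left shortCoeffs hw
    have hv' := List.mem_append_right longCoeffs hv
    have hl' := List.mem_append_right longCoeffs hl
    have hm' := List.mem_append_left shortCoeffs hm
    have hk := hadd u hu' w hw' hv'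
    refine G.coordAlg_le_of_triple ρ hk (hadd u hu' _ hv' hl') (hadd u hu' _ hl' hm')
      (hadd w hw' _ hm' (List.mem_append_left _ ho)) (linearIndependent_of_root_eq_add hk)
      (fun a b hab h => hnot (a, b) hab (hrange _ ?_)) (isUnit_chainBotCoeff_add_one hk h2 h3) h2 h3
      (hsmul w hw) (hsmul _ hm) (hsq _ ho)
    rwa [← hcomb u hu' w hw' a b]
  have hall : ∀ i, coordAlg (G.oneParam ρ i) = A (0, 1) := by
    intro i
    obtain ⟨v, hv, rfl⟩ := hsurj i
    rcases List.mem_append.1 hv with hv | hv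
    · exact hlong v hv
    · exact le_antisymm (hshort_le v hv) (hlong_le v hv)
  obtain ⟨i, j, h, -⟩ := hlong_mul (0, 1) (by decide)
  exact ⟨fun i j => (hall i).trans (hall j).symm, i, j, _, h⟩

omit [P.IsReduced] in
/-- In an irreducible root system of rank at least two, the sum of some two roots is a root. -/
lemma exists_root_eq_add [Nontrivial V] (hrank : 2 ≤ Module.finrank ℝ V) :
    ∃ i j k, P.root k = P.root i + P.root j := by
  by_contra! h
  have : Nonempty ι := by
    by_contra hι
    rw [not_nonempty_iff] at hι
    have := RootPairing.IsRootSystem.span_root_eq_top (P := P)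
    rw [Set.range_eq_empty, Submodule.span_empty] at this
    exact bot_ne_top this
  obtain ⟨i⟩ := this
  -- If no two roots had a root as their sum, even the identity function would satisfy the
  -- hypothesis of `eq_of_forall_root_add`, and a root would equal its negative.
  have h1 := eq_of_forall_root_add (P := P) hrank (f := id) (fun i j k hk => (h i j k hk).elim) i
    (P.reflectionPerm i i)
  have h2 : P.root i = -P.root i := by
    conv_lhs => rw [show i = P.reflectionPerm i i from h1]
    simp
  have : IsAddTorsionFree V := .of_isTorsionFree ℝ V
  exact P.ne_zero i (self_eq_neg.1 h2)

end UniversalLattice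

end TypeG2

end

/-! ### The main theorem -/

theorem theoremT
    {ι V W : Type*} [Finite ι] [AddCommGroup V] [Module ℝ V] [AddCommGroup W] [Module ℝ W]
    -- a reduced irreducible root system `Φ` of rank at least two
    (P : RootPairing ι ℝ V W) [P.IsRootSystem] [P.IsCrystallographic] [P.IsReduced]
    [P.IsIrreducible] (hrank : 2 ≤ Module.finrank ℝ V)
    -- the universal Chevalley–Demazure group scheme `G` of type `Φ`, in any of its constructions
    -- from a complex semisimple Lie algebra, a Chevalley basis and an admissible lattice
    {L : Type*} [LieRing L] [LieAlgebra ℂ L] [FiniteDimensional ℂ L] [LieAlgebra.IsKilling ℂ L]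
    (H : LieSubalgebra ℂ L) [H.IsCartanSubalgebra] (B : ChevalleyBasis P H)
    {N : ℕ} (G : UniversalLattice B N)
    -- a commutative ring `R` such that `(Φ, R)` is a nice pair
    (R : Type*) [CommRing R] (hnice : IsNicePair P R)
    -- a representation of the elementary subgroup `G(R)⁺`
    (K : Type*) [Field K] [IsAlgClosed K] (n : ℕ) (ρ : G.elementary R →* GL (Fin n) K) :
    ∃ (A : CommAlgebraicRing K) (f : R →+* A.carrier),
      A.IsZariskiDense (Set.range f) ∧
      ∀ α : ι, ∃ ψ : A.carrier → glZariskiClosure (Set.range ρ),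
        Function.Injective ψ ∧
        IsRegularMap (fun a : A.carrier => (a : Fin A.ambientDim → K))
          (fun a => glCoord ((ψ a : glZariskiClosure (Set.range ρ)) : GL (Fin n) K)) ∧
        ∀ t : R, ρ (G.elem α t) = ψ (f t) := by
  have : Nontrivial V := Module.nontrivial_of_finrank_pos (R := ℝ) (by omega)
  obtain ⟨heq, i, j, k, hmul⟩ :
      (∀ i j, coordAlg (G.oneParam ρ i) = coordAlg (G.oneParam ρ j)) ∧
        ∃ i j k, HasMul (G.oneParam ρ) i j k := by
    by_cases hG : P.IsG2
    · exact G.coordAlg_eq_of_isG2 ρ hG (hnice.2 hG).1 (hnice.2 hG).2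
    · rw [P.not_isG2_iff_isNotG2] at hG
      refine ⟨G.coordAlg_eq_of_isNotG2 ρ hrank hG hnice.1, ?_⟩
      obtain ⟨i, j, k, hk⟩ := UniversalLattice.exists_root_eq_add (P := P) hrank
      rcases G.hasMul_of_isNotG2 ρ hG hnice.1 hk with h | h
      exacts [⟨i, j, k, h⟩, ⟨j, i, k, h⟩]
  exact exists_algebraicRing (G.oneParam_add ρ) heq hmul (Γ := Set.range ρ) fun i t => ⟨_, rfl⟩
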